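/- Let $L_x,L_y>0$ and let $\boldsymbol u=(u,v,w)$, $p$, $T$ be a classical solution on $t\ge 0$, $(x,y)\in\mathbb R^2$, $0\le z\le 1$ (with $\boldsymbol u,T$ of class $C^2$ and $p$ of class $C^1$ up to $z\in\{0,1\}$ and up to $t=0$), periodic in $x$ with period $L_x$ and in $y$ with period $L_y$, of internally heated convection at infinite Prandtl number with Rayleigh number $R$, $$\nabla\cdot\boldsymbol u=0,\qquad \nabla p=\Delta\boldsymbol u+R\,T\,\hat{\boldsymbol z},\qquad \partial_t T+\boldsymbol u\cdot\nabla T=\Delta T+1,$$ between stress-free isothermal plates: $w=\partial_z u=\partial_z v=0$ and $T=0$ at $z=0$ and at $z=1$. Write $\langle f\rangle_h=\frac1{L_xL_y}\int_0^{L_x}\!\int_0^{L_y} f\,dy\,dx$, $\langle f\rangle=\int_0^1\langle f\rangle_h\,dz$ and $\overline{g}=\limsup_{\tau\to\infty}\frac1\tau\int_0^\tau g(t)\,dt$. Let $\mathcal F_B=\overline{\langle\partial_zT\rangle_h|_{z=0}}$ be the mean heat flux out of the bottom plate. Put $$m_1=\tfrac16\Big(\tfrac{2^{49}5^3}{3^{30}}\Big)^{2/29},\qquad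 m_2=\frac{2^{3/4}}{3^{5/2}5^{1/4}}(6m_1)^{7/8},\qquad m_3=\big(\tfrac{20}{27}m_1\big)^{1/4}.$$ There is a constant $R_0>1$, independent of $L_x$, $L_y$ and of the solution, such that for all $R>R_0$ and all such solutions $$\mathcal F_B\;\ge\; m_1R^{-40/29}-m_2R^{-35/29}\ln\!\big(1-m_3R^{-10/29}\big),$$ and also $\frac12-\overline{\langle wT\rangle}\;\ge\; m_1R^{-40/29}-m_2R^{-35/29}\ln\!\big(1-m_3R^{-10/29}\big)$. -/

import Mathlib

open Set Filter MeasureTheory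

noncomputable section

namespace HeatedConvection

/-- A scalar field `f t x y z` of time `t ≥ 0`, horizontal position `(x, y) ∈ ℝ²` and height
`z ∈ [0, 1]`; values outside this range play no role. -/
abbrev ScalarField : Type := ℝ → ℝ → ℝ → ℝ → ℝ

/-- Time derivative on `[0, ∞)` (one-sided at `t = 0`). -/
def dt (f : ScalarField) : ScalarField :=
  fun t x y z => derivWithin (fun s => f s x y z) (Ici 0) t

/-- Partial derivative in `x`. -/
def dx (f : ScalarField) : ScalarField :=
  fun t x y z => deriv (fun s => f t s y z) x

/-- Partial derivative in `y`. -/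
def dy (f : ScalarField) : ScalarField :=
  fun t x y z => deriv (fun s => f t x s z) y

/-- Partial derivative in `z` on `[0, 1]` (one-sided at the two plates). -/
def dz (f : ScalarField) : ScalarField :=
  fun t x y z => derivWithin (fun s => f t x y s) (Icc 0 1) z

/-- The Laplacian in the three space variables. -/
def laplacian (f : ScalarField) : ScalarField :=
  fun t x y z => dx (dx f) t x y z + dy (dy f) t x y z + dz (dz f) t x y z

/-- The space-time domain `[0, ∞) × ℝ × ℝ × [0, 1]`. -/
def domain : Set (ℝ × ℝ × ℝ × ℝ) :=
  Ici 0 ×ˢ (univ : Set ℝ) ×ˢ (univ : Set ℝ) ×ˢ Icc 0 1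

/-- `f` is of class `C^n` in all variables jointly, up to the plates and up to `t = 0`. -/
def IsOfClass (n : ℕ) (f : ScalarField) : Prop :=
  ContDiffOn ℝ n (fun q : ℝ × ℝ × ℝ × ℝ => f q.1 q.2.1 q.2.2.1 q.2.2.2) domain

/-- `f` is periodic in `x` with period `Lx` and in `y` with period `Ly`. -/
def HorizontallyPeriodic (Lx Ly : ℝ) (f : ScalarField) : Prop :=
  ∀ t x y z : ℝ, 0 ≤ t → z ∈ Icc (0 : ℝ) 1 →
    f t (x + Lx) y z = f t x y z ∧ f t x (y + Ly) z = f t x y z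

/-- `(u, v, w)`, `p`, `T` is a (global, classical) solution of uniform internally heated Boussinesq
convection at infinite Prandtl number with Rayleigh number `R`, horizontally periodic with periods
`Lx`, `Ly`, between stress-free plates `z = 0` and `z = 1` that are held at temperature `0`. -/
structure IsStressFreeSolution (R Lx Ly : ℝ) (u v w p T : ScalarField) : Prop where
  regular_u : IsOfClass 2 u
  regular_v : IsOfClass 2 v
  regular_w : IsOfClass 2 w
  regular_p : IsOfClass 1 p
  regular_T : IsOfClass 2 T
  periodic_u : HorizontallyPeriodic Lx Ly u
  periodic_v : HorizontallyPeriodic Lx Ly v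
  periodic_w : HorizontallyPeriodic Lx Ly w
  periodic_p : HorizontallyPeriodic Lx Ly p
  periodic_T : HorizontallyPeriodic Lx Ly T
  /-- incompressibility, `∇ · u = 0` -/
  incompressible : ∀ t x y z : ℝ, 0 ≤ t → z ∈ Icc (0 : ℝ) 1 →
    dx u t x y z + dy v t x y z + dz w t x y z = 0
  /-- momentum balance, `∇ p = Δ u + R T e_z` -/
  momentum_x : ∀ t x y z : ℝ, 0 ≤ t → z ∈ Icc (0 : ℝ) 1 →
    dx p t x y z = laplacian u t x y z
  momentum_y : ∀ t x y z : ℝ, 0 ≤ t → z ∈ Icc (0 : ℝ) 1 →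
    dy p t x y z = laplacian v t x y z
  momentum_z : ∀ t x y z : ℝ, 0 ≤ t → z ∈ Icc (0 : ℝ) 1 →
    dz p t x y z = laplacian w t x y z + R * T t x y z
  /-- heat equation, `∂ₜ T + u · ∇ T = Δ T + 1` -/
  heat : ∀ t x y z : ℝ, 0 ≤ t → z ∈ Icc (0 : ℝ) 1 →
    dt T t x y z
        + (u t x y z * dx T t x y z + v t x y z * dy T t x y z + w t x y z * dz T t x y z)
      = laplacian T t x y z + 1
  /-- impermeable plates -/
  bc_w : ∀ t x y z : ℝ, 0 ≤ t → z = 0 ∨ z = 1 → w t x y z = 0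
  /-- no tangential stress at the plates -/
  bc_u : ∀ t x y z : ℝ, 0 ≤ t → z = 0 ∨ z = 1 → dz u t x y z = 0
  bc_v : ∀ t x y z : ℝ, 0 ≤ t → z = 0 ∨ z = 1 → dz v t x y z = 0
  /-- isothermal plates -/
  bc_T : ∀ t x y z : ℝ, 0 ≤ t → z = 0 ∨ z = 1 → T t x y z = 0

/-- Average over the horizontal periodicity cell at time `t` and height `z`. -/
def horizontalAverage (Lx Ly : ℝ) (f : ScalarField) (t z : ℝ) : ℝ :=
  1 / (Lx * Ly) * ∫ x in (0 : ℝ)..Lx, ∫ y in (0 : ℝ)..Ly, f t x y z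

/-- Average over the fluid volume at time `t`. -/
def volumeAverage (Lx Ly : ℝ) (f : ScalarField) (t : ℝ) : ℝ :=
  ∫ z in (0 : ℝ)..1, horizontalAverage Lx Ly f t z

/-- Infinite-time average `limsup_{τ → ∞} τ⁻¹ ∫₀^τ g(t) dt`, as an extended real number. -/
def longTimeAverage (g : ℝ → ℝ) : EReal :=
  limsup (fun τ : ℝ => ((1 / τ * ∫ t in (0 : ℝ)..τ, g t : ℝ) : EReal)) atTop

/-- The mean heat flux out of the bottom plate: the long-time and horizontal average of `∂_z T`
at `z = 0`. -/
def bottomFlux (Lx Ly : ℝ) (T : ScalarField) : EReal :=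
  longTimeAverage fun t => horizontalAverage Lx Ly (dz T) t 0

/-- The mean vertical convective heat flux: the long-time and volume average of `w T`. -/
def meanConvectiveFlux (Lx Ly : ℝ) (w T : ScalarField) : EReal :=
  longTimeAverage fun t => volumeAverage Lx Ly (fun t x y z => w t x y z * T t x y z) t

/-- `m₁ = (1/6) (2⁴⁹ 5³ / 3³⁰)^{2/29}` -/
def m₁ : ℝ := 1 / 6 * ((2 : ℝ) ^ 49 * 5 ^ 3 / 3 ^ 30) ^ ((2 : ℝ) / 29)

/-- `m₂ = 2^{3/4} / (3^{5/2} 5^{1/4}) (6 m₁)^{7/8}` -/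
def m₂ : ℝ :=
  (2 : ℝ) ^ ((3 : ℝ) / 4) / ((3 : ℝ) ^ ((5 : ℝ) / 2) * (5 : ℝ) ^ ((1 : ℝ) / 4))
    * (6 * m₁) ^ ((7 : ℝ) / 8)

/-- `m₃ = (20 m₁ / 27)^{1/4}` -/
def m₃ : ℝ := (20 / 27 * m₁) ^ ((1 : ℝ) / 4)

/-- The lower bound `m₁ R^{-40/29} - m₂ R^{-35/29} ln (1 - m₃ R^{-10/29})`. -/
def stressFreeBound (R : ℝ) : ℝ :=
  m₁ * R ^ (-(40 : ℝ) / 29)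
    - m₂ * R ^ (-(35 : ℝ) / 29) * Real.log (1 - m₃ * R ^ (-(10 : ℝ) / 29))

end HeatedConvection

end

/-!
The time-integrated balance of `ψ(z) T` for the polynomial profile `ψ = (1 - z) - (1 - z)^k`, which
vanishes at both plates, reads (`layer_balance`), up to the values of `⟨ψ T⟩` at the two end times,

  mean of `w T` = `1 / 2 - 1 / (k + 1)` + mean of `k (1 - z)^(k-1) w T - k (k-1) (1 - z)^(k-2) T`.

The gain `1 / (k + 1)` is kept if the last mean is smaller, that is, if the convective flux through
a bottom layer of thickness `1 / k` is dominated by the negative curvature term. That term is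
*linear* in `T`, and this is where positivity of the temperature enters. Young's inequality splits
the layer flux into `w ^ 2` and `T ^ 2` (`convection_le_pointwise`).

* The part with `w ^ 2` is bounded by `R` times the mean of `w T`, with a small factor: `w` vanishes
  at the plate, so a Hardy inequality (`weighted_hardy`) bounds it by the mean of `(∂_z w) ^ 2`, and
  the mechanical energy balance (`dissipation_le`) bounds the latter. The result is absorbed on the
  left.
* In the part with `T ^ 2`, use `T ^ 2 ≤ l |T| + T ^ 16 / l ^ 14`. The threshold `l` is chosen so
  that `l T` cancels the curvature term. The mean of `T ^ 16` is bounded uniformly in `R`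
  (`moment_bound`), because advection does not enter the balance of a function of `T`.
* The difference between `|T|` and `T` is twice the negative part of `T`, whose long-time mean is
  zero (`exists_negPart_le`): in the balance of `min(T, 0) ^ 4` the heat source has a favourable
  sign.

All of this works for `k` of order `R ^ (4 / 3)` (`exists_layer`), so that both quantities are
bounded below by a multiple of `R ^ (-4 / 3)`. Since `4 / 3 < 40 / 29`, this exceeds the stated
bound for large `R` (`eventually_stressFreeBound_le`). The flux through the bottom plate
follows from the balance of `(1 - z) T` (`plateIntegral_bottom`), in which the boundary term in time
grows sublinearly (`exists_abs_cellIntegral_le`).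
-/

namespace HeatedConvection

/-! ### Calculus of fields on the space-time domain -/

/-- `f` is jointly continuous on the space-time domain, up to the plates and up to `t = 0`. -/
def IsCont (f : ScalarField) : Prop :=
  ContinuousOn (fun q : ℝ × ℝ × ℝ × ℝ => f q.1 q.2.1 q.2.2.1 q.2.2.2) domain

lemma mem_domain {t x y z : ℝ} (ht : 0 ≤ t) (hz : z ∈ Icc (0 : ℝ) 1) :
    ((t, x, y, z) : ℝ × ℝ × ℝ × ℝ) ∈ domain :=
  ⟨ht, mem_univ _, mem_univ _, hz⟩

lemma uniqueDiffOn_domain : UniqueDiffOn ℝ domain :=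
  (uniqueDiffOn_Ici 0).prod (uniqueDiffOn_univ.prod (uniqueDiffOn_univ.prod
    (uniqueDiffOn_Icc zero_lt_one)))

lemma IsOfClass.isCont {n : ℕ} {f : ScalarField} (hf : IsOfClass n f) : IsCont f :=
  ContDiffOn.continuousOn hf

lemma IsOfClass.of_le {m n : ℕ} {f : ScalarField} (hf : IsOfClass n f) (h : m ≤ n) :
    IsOfClass m f :=
  ContDiffOn.of_le hf (by exact_mod_cast h)

lemma IsOfClass.hasFDerivWithinAt {f : ScalarField} (hf : IsOfClass 1 f) {q : ℝ × ℝ × ℝ × ℝ}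
    (hq : q ∈ domain) :
    HasFDerivWithinAt (fun q : ℝ × ℝ × ℝ × ℝ => f q.1 q.2.1 q.2.2.1 q.2.2.2)
      (fderivWithin ℝ (fun q : ℝ × ℝ × ℝ × ℝ => f q.1 q.2.1 q.2.2.1 q.2.2.2) domain q) domain q :=
  ((ContDiffOn.differentiableOn hf (by norm_num)) q hq).hasFDerivWithinAt

section Partial

variable {f : ScalarField} {t x y z : ℝ}

lemma IsOfClass.hasDerivWithinAt_curve (hf : IsOfClass 1 f) {γ : ℝ → ℝ × ℝ × ℝ × ℝ}
    {e : ℝ × ℝ × ℝ × ℝ} {S : Set ℝ} {s : ℝ} (hγ : HasDerivWithinAt γ e S s)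
    (hS : MapsTo γ S domain) (hs : γ s ∈ domain) :
    HasDerivWithinAt (fun r => f (γ r).1 (γ r).2.1 (γ r).2.2.1 (γ r).2.2.2)
      (fderivWithin ℝ (fun q : ℝ × ℝ × ℝ × ℝ => f q.1 q.2.1 q.2.2.1 q.2.2.2) domain (γ s) e) S s :=
  (hf.hasFDerivWithinAt hs).comp_hasDerivWithinAt s hγ hS

lemma IsOfClass.hasDerivWithinAt_dt_aux (hf : IsOfClass 1 f) (ht : 0 ≤ t)
    (hz : z ∈ Icc (0 : ℝ) 1) :
    HasDerivWithinAt (fun s => f s x y z)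
      (fderivWithin ℝ (fun q : ℝ × ℝ × ℝ × ℝ => f q.1 q.2.1 q.2.2.1 q.2.2.2) domain
        (t, x, y, z) (1, 0, 0, 0)) (Ici 0) t :=
  hf.hasDerivWithinAt_curve (γ := fun s => (s, x, y, z))
    ((hasDerivWithinAt_id t _).prodMk <| (hasDerivWithinAt_const t _ x).prodMk <|
      (hasDerivWithinAt_const t _ y).prodMk (hasDerivWithinAt_const t _ z))
    (fun _ hs => mem_domain hs hz) (mem_domain ht hz)

lemma IsOfClass.hasDerivAt_dx_aux (hf : IsOfClass 1 f) (ht : 0 ≤ t)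
    (hz : z ∈ Icc (0 : ℝ) 1) :
    HasDerivAt (fun s => f t s y z)
      (fderivWithin ℝ (fun q : ℝ × ℝ × ℝ × ℝ => f q.1 q.2.1 q.2.2.1 q.2.2.2) domain
        (t, x, y, z) (0, 1, 0, 0)) x :=
  hasDerivWithinAt_univ.1 <| hf.hasDerivWithinAt_curve (γ := fun s => (t, s, y, z))
    ((hasDerivWithinAt_const x _ t).prodMk <| (hasDerivWithinAt_id x _).prodMk <|
      (hasDerivWithinAt_const x _ y).prodMk (hasDerivWithinAt_const x _ z))
    (fun _ _ => mem_domain ht hz) (mem_domain ht hz)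

lemma IsOfClass.hasDerivAt_dy_aux (hf : IsOfClass 1 f) (ht : 0 ≤ t)
    (hz : z ∈ Icc (0 : ℝ) 1) :
    HasDerivAt (fun s => f t x s z)
      (fderivWithin ℝ (fun q : ℝ × ℝ × ℝ × ℝ => f q.1 q.2.1 q.2.2.1 q.2.2.2) domain
        (t, x, y, z) (0, 0, 1, 0)) y :=
  hasDerivWithinAt_univ.1 <| hf.hasDerivWithinAt_curve (γ := fun s => (t, x, s, z))
    ((hasDerivWithinAt_const y _ t).prodMk <| (hasDerivWithinAt_const y _ x).prodMk <|
      (hasDerivWithinAt_id y _).prodMk (hasDerivWithinAt_const y _ z))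
    (fun _ _ => mem_domain ht hz) (mem_domain ht hz)

lemma IsOfClass.hasDerivWithinAt_dz_aux (hf : IsOfClass 1 f) (ht : 0 ≤ t)
    (hz : z ∈ Icc (0 : ℝ) 1) :
    HasDerivWithinAt (fun s => f t x y s)
      (fderivWithin ℝ (fun q : ℝ × ℝ × ℝ × ℝ => f q.1 q.2.1 q.2.2.1 q.2.2.2) domain
        (t, x, y, z) (0, 0, 0, 1)) (Icc 0 1) z :=
  hf.hasDerivWithinAt_curve (γ := fun s => (t, x, y, s))
    ((hasDerivWithinAt_const z _ t).prodMk <| (hasDerivWithinAt_const z _ x).prodMk <|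
      (hasDerivWithinAt_const z _ y).prodMk (hasDerivWithinAt_id z _))
    (fun _ hs => mem_domain ht hs) (mem_domain ht hz)

lemma IsOfClass.hasDerivWithinAt_dt (hf : IsOfClass 1 f) (ht : 0 ≤ t) (hz : z ∈ Icc (0 : ℝ) 1) :
    HasDerivWithinAt (fun s => f s x y z) (dt f t x y z) (Ici 0) t :=
  (hf.hasDerivWithinAt_dt_aux ht hz).differentiableWithinAt.hasDerivWithinAt

lemma IsOfClass.hasDerivAt_dx (hf : IsOfClass 1 f) (ht : 0 ≤ t) (hz : z ∈ Icc (0 : ℝ) 1) :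
    HasDerivAt (fun s => f t s y z) (dx f t x y z) x :=
  (hf.hasDerivAt_dx_aux ht hz).differentiableAt.hasDerivAt

lemma IsOfClass.hasDerivAt_dy (hf : IsOfClass 1 f) (ht : 0 ≤ t) (hz : z ∈ Icc (0 : ℝ) 1) :
    HasDerivAt (fun s => f t x s z) (dy f t x y z) y :=
  (hf.hasDerivAt_dy_aux ht hz).differentiableAt.hasDerivAt

lemma IsOfClass.hasDerivWithinAt_dz (hf : IsOfClass 1 f) (ht : 0 ≤ t) (hz : z ∈ Icc (0 : ℝ) 1) :
    HasDerivWithinAt (fun s => f t x y s) (dz f t x y z) (Icc 0 1) z :=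
  (hf.hasDerivWithinAt_dz_aux ht hz).differentiableWithinAt.hasDerivWithinAt

end Partial

/-- A field that agrees on the domain with a directional derivative of a `C^(n+1)` field is of
class `C^n`. -/
lemma IsOfClass.of_fderivWithin {n : ℕ} {f g : ScalarField} (hf : IsOfClass (n + 1) f)
    (e : ℝ × ℝ × ℝ × ℝ)
    (hg : ∀ t x y z : ℝ, 0 ≤ t → z ∈ Icc (0 : ℝ) 1 → g t x y z =
      fderivWithin ℝ (fun q : ℝ × ℝ × ℝ × ℝ => f q.1 q.2.1 q.2.2.1 q.2.2.2) domain
        (t, x, y, z) e) : IsOfClass n g :=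
  ((ContDiffOn.fderivWithin hf uniqueDiffOn_domain
    (by norm_cast)).clm_apply contDiffOn_const).congr
      (fun q hq => hg q.1 q.2.1 q.2.2.1 q.2.2.2 hq.1 hq.2.2.2)

section Classes

variable {n : ℕ} {f : ScalarField}

lemma IsOfClass.dt (hf : IsOfClass (n + 1) f) : IsOfClass n (dt f) :=
  hf.of_fderivWithin (1, 0, 0, 0) fun _ _ _ _ ht hz =>
    ((hf.of_le (Nat.le_add_left 1 n)).hasDerivWithinAt_dt_aux ht hz).derivWithin
      (uniqueDiffOn_Ici 0 _ ht)

lemma IsOfClass.dx (hf : IsOfClass (n + 1) f) : IsOfClass n (dx f) :=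
  hf.of_fderivWithin (0, 1, 0, 0) fun _ _ _ _ ht hz =>
    ((hf.of_le (Nat.le_add_left 1 n)).hasDerivAt_dx_aux ht hz).deriv

lemma IsOfClass.dy (hf : IsOfClass (n + 1) f) : IsOfClass n (dy f) :=
  hf.of_fderivWithin (0, 0, 1, 0) fun _ _ _ _ ht hz =>
    ((hf.of_le (Nat.le_add_left 1 n)).hasDerivAt_dy_aux ht hz).deriv

lemma IsOfClass.dz (hf : IsOfClass (n + 1) f) : IsOfClass n (dz f) :=
  hf.of_fderivWithin (0, 0, 0, 1) fun _ _ _ _ ht hz =>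
    ((hf.of_le (Nat.le_add_left 1 n)).hasDerivWithinAt_dz_aux ht hz).derivWithin
      (uniqueDiffOn_Icc zero_lt_one _ hz)

end Classes

section Periodic

variable {Lx Ly : ℝ} {f : ScalarField} {t x y z : ℝ}

lemma HorizontallyPeriodic.at_Lx (hf : HorizontallyPeriodic Lx Ly f) (ht : 0 ≤ t)
    (hz : z ∈ Icc (0 : ℝ) 1) : f t Lx y z = f t 0 y z := by
  simpa using (hf t 0 y z ht hz).1

lemma HorizontallyPeriodic.at_Ly (hf : HorizontallyPeriodic Lx Ly f) (ht : 0 ≤ t)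
    (hz : z ∈ Icc (0 : ℝ) 1) : f t x Ly z = f t x 0 z := by
  simpa using (hf t x 0 z ht hz).2

lemma HorizontallyPeriodic.dx_at_Lx (hf : HorizontallyPeriodic Lx Ly f) (ht : 0 ≤ t)
    (hz : z ∈ Icc (0 : ℝ) 1) : dx f t Lx y z = dx f t 0 y z := by
  have h := deriv_comp_add_const (f := fun s => f t s y z) Lx 0
  simp only [(hf t _ y z ht hz).1, zero_add] at h
  exact h.symm

lemma HorizontallyPeriodic.dy_at_Ly (hf : HorizontallyPeriodic Lx Ly f) (ht : 0 ≤ t)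
    (hz : z ∈ Icc (0 : ℝ) 1) : dy f t x Ly z = dy f t x 0 z := by
  have h := deriv_comp_add_const (f := fun s => f t x s z) Ly 0
  simp only [(hf t x _ z ht hz).2, zero_add] at h
  exact h.symm

end Periodic

section Continuity

variable {f g : ScalarField}

lemma IsCont.add (hf : IsCont f) (hg : IsCont g) :
    IsCont fun t x y z => f t x y z + g t x y z :=
  ContinuousOn.add hf hg

lemma IsCont.sub (hf : IsCont f) (hg : IsCont g) :
    IsCont fun t x y z => f t x y z - g t x y z :=
  ContinuousOn.sub hf hg

lemma IsCont.mul (hf : IsCont f) (hg : IsCont g) :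
    IsCont fun t x y z => f t x y z * g t x y z :=
  ContinuousOn.mul hf hg

lemma IsCont.pow (hf : IsCont f) (n : ℕ) : IsCont fun t x y z => f t x y z ^ n :=
  ContinuousOn.pow hf n

lemma IsCont.comp {φ : ℝ → ℝ} (hφ : Continuous φ) (hf : IsCont f) :
    IsCont fun t x y z => φ (f t x y z) :=
  hφ.comp_continuousOn hf

lemma isCont_const (c : ℝ) : IsCont fun _ _ _ _ => c :=
  continuousOn_const

lemma isCont_height {ψ : ℝ → ℝ} (hψ : Continuous ψ) : IsCont fun _ _ _ z => ψ z :=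
  (hψ.comp (continuous_snd.comp (continuous_snd.comp continuous_snd))).continuousOn

end Continuity

/-! ### Integrals over the periodicity cell and over space-time -/

/-- The fundamental theorem of calculus on `[a, b]`, as a set integral. -/
lemma setIntegral_Icc_eq_sub {a b : ℝ} (hab : a ≤ b) {F F' : ℝ → ℝ}
    (hF : ∀ s ∈ Icc a b, HasDerivWithinAt F (F' s) (Icc a b) s) (hF' : ContinuousOn F' (Icc a b)) :
    ∫ s in Icc a b, F' s = F b - F a := by
  rw [integral_Icc_eq_integral_Ioc, ← intervalIntegral.integral_of_le hab]
  refine intervalIntegral.integral_eq_sub_of_hasDerivAt_of_le hab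
    (fun s hs => (hF s hs).continuousWithinAt)
    (fun s hs => (hF s (Ioo_subset_Icc_self hs)).hasDerivAt (Icc_mem_nhds hs.1 hs.2)) ?_
  exact ContinuousOn.intervalIntegrable_of_Icc hab hF'

lemma continuousOn_slice {α β : Type*} [TopologicalSpace α] [TopologicalSpace β] {s : Set α}
    {t : Set β} {f : α × β → ℝ} (hf : ContinuousOn f (s ×ˢ t)) {x : α} (hx : x ∈ s) :
    ContinuousOn (fun y => f (x, y)) t :=
  hf.comp (by fun_prop) fun _ hy => ⟨hx, hy⟩

section Fubini

variable {α β : Type*} [TopologicalSpace α] [TopologicalSpace β] [MeasureSpace α] [MeasureSpace β]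
  [OpensMeasurableSpace (α × β)] [SFinite (volume : Measure α)] [SFinite (volume : Measure β)]
  [IsFiniteMeasureOnCompacts (volume : Measure (α × β))] [T2Space α] [T2Space β]
  {s : Set α} {t : Set β} {f : α × β → ℝ}

lemma setIntegral_prod_of_continuousOn (hs : IsCompact s) (ht : IsCompact t)
    (hf : ContinuousOn f (s ×ˢ t)) : ∫ q in s ×ˢ t, f q = ∫ x in s, ∫ y in t, f (x, y) :=
  setIntegral_prod f (hf.integrableOn_compact (hs.prod ht))

lemma setIntegral_prod_symm_of_continuousOn (hs : IsCompact s) (ht : IsCompact t)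
    (hf : ContinuousOn f (s ×ˢ t)) : ∫ q in s ×ˢ t, f q = ∫ y in t, ∫ x in s, f (x, y) := by
  have h : IntegrableOn f (s ×ˢ t) ((volume : Measure α).prod volume) :=
    hf.integrableOn_compact (hs.prod ht)
  have h' : IntegrableOn (fun q : β × α => f q.swap) (t ×ˢ s)
      ((volume : Measure β).prod volume) := by
    rw [IntegrableOn, ← Measure.prod_restrict] at h ⊢
    exact h.swap
  rw [Measure.volume_eq_prod, ← setIntegral_prod_swap s t f]
  exact setIntegral_prod _ h'

end Fubini

/-- The periodicity cell `[0, Lx] × [0, Ly] × [0, 1]`. -/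
def cell (Lx Ly : ℝ) : Set (ℝ × ℝ × ℝ) := Icc 0 Lx ×ˢ Icc 0 Ly ×ˢ Icc 0 1

/-- The integral over the periodicity cell at time `t`. -/
noncomputable def cellIntegral (Lx Ly : ℝ) (f : ScalarField) (t : ℝ) : ℝ :=
  ∫ q in cell Lx Ly, f t q.1 q.2.1 q.2.2

/-- The integral over the periodicity cell and over the times in `[0, τ]`. -/
noncomputable def spaceTimeIntegral (Lx Ly τ : ℝ) (f : ScalarField) : ℝ :=
  ∫ q in Icc 0 τ ×ˢ cell Lx Ly, f q.1 q.2.1 q.2.2.1 q.2.2.2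

/-- The integral over one horizontal period of a plate and over the times in `[0, τ]`. -/
noncomputable def plateIntegral (Lx Ly τ : ℝ) (g : ℝ → ℝ → ℝ → ℝ) : ℝ :=
  ∫ t in Icc 0 τ, ∫ x in Icc 0 Lx, ∫ y in Icc 0 Ly, g t x y

section Integrals

variable {Lx Ly τ t : ℝ} {f g : ScalarField}

lemma isCompact_cell : IsCompact (cell Lx Ly) :=
  isCompact_Icc.prod (isCompact_Icc.prod isCompact_Icc)

lemma measurableSet_cell : MeasurableSet (cell Lx Ly) :=
  isCompact_cell.measurableSet

lemma IsCont.continuousOn_spaceTime (hf : IsCont f) :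
    ContinuousOn (fun q : ℝ × ℝ × ℝ × ℝ => f q.1 q.2.1 q.2.2.1 q.2.2.2)
      (Icc 0 τ ×ˢ cell Lx Ly) :=
  hf.mono fun _ hq => ⟨hq.1.1, mem_univ _, mem_univ _, hq.2.2.2⟩

lemma IsCont.continuousOn_cell (hf : IsCont f) (ht : 0 ≤ t) :
    ContinuousOn (fun q : ℝ × ℝ × ℝ => f t q.1 q.2.1 q.2.2) (cell Lx Ly) :=
  continuousOn_slice (hf.continuousOn_spaceTime (τ := t)) ⟨ht, le_rfl⟩

lemma IsCont.integrableOn_spaceTime (hf : IsCont f) :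
    IntegrableOn (fun q : ℝ × ℝ × ℝ × ℝ => f q.1 q.2.1 q.2.2.1 q.2.2.2)
      (Icc 0 τ ×ˢ cell Lx Ly) :=
  hf.continuousOn_spaceTime.integrableOn_compact (isCompact_Icc.prod isCompact_cell)

lemma IsCont.integrableOn_cell (hf : IsCont f) (ht : 0 ≤ t) :
    IntegrableOn (fun q : ℝ × ℝ × ℝ => f t q.1 q.2.1 q.2.2) (cell Lx Ly) :=
  (hf.continuousOn_cell ht).integrableOn_compact isCompact_cell

lemma spaceTimeIntegral_add (hf : IsCont f) (hg : IsCont g) :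
    spaceTimeIntegral Lx Ly τ (fun t x y z => f t x y z + g t x y z)
      = spaceTimeIntegral Lx Ly τ f + spaceTimeIntegral Lx Ly τ g :=
  integral_add hf.integrableOn_spaceTime hg.integrableOn_spaceTime

lemma spaceTimeIntegral_sub (hf : IsCont f) (hg : IsCont g) :
    spaceTimeIntegral Lx Ly τ (fun t x y z => f t x y z - g t x y z)
      = spaceTimeIntegral Lx Ly τ f - spaceTimeIntegral Lx Ly τ g :=
  integral_sub hf.integrableOn_spaceTime hg.integrableOn_spaceTime

lemma spaceTimeIntegral_const_mul (c : ℝ) :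
    spaceTimeIntegral Lx Ly τ (fun t x y z => c * f t x y z)
      = c * spaceTimeIntegral Lx Ly τ f :=
  integral_const_mul _ _

lemma spaceTimeIntegral_mono (hf : IsCont f) (hg : IsCont g)
    (h : ∀ t x y z : ℝ, 0 ≤ t → z ∈ Icc (0 : ℝ) 1 → f t x y z ≤ g t x y z) :
    spaceTimeIntegral Lx Ly τ f ≤ spaceTimeIntegral Lx Ly τ g :=
  setIntegral_mono_on hf.integrableOn_spaceTime hg.integrableOn_spaceTime
    (measurableSet_Icc.prod measurableSet_cell)
    fun q hq => h q.1 q.2.1 q.2.2.1 q.2.2.2 hq.1.1 hq.2.2.2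

lemma spaceTimeIntegral_congr
    (h : ∀ t x y z : ℝ, 0 ≤ t → z ∈ Icc (0 : ℝ) 1 → f t x y z = g t x y z) :
    spaceTimeIntegral Lx Ly τ f = spaceTimeIntegral Lx Ly τ g :=
  setIntegral_congr_fun (measurableSet_Icc.prod measurableSet_cell)
    fun q hq => h q.1 q.2.1 q.2.2.1 q.2.2.2 hq.1.1 hq.2.2.2

lemma cellIntegral_mono (hf : IsCont f) (hg : IsCont g) (ht : 0 ≤ t)
    (h : ∀ x y z : ℝ, z ∈ Icc (0 : ℝ) 1 → f t x y z ≤ g t x y z) :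
    cellIntegral Lx Ly f t ≤ cellIntegral Lx Ly g t :=
  setIntegral_mono_on (hf.integrableOn_cell ht) (hg.integrableOn_cell ht) measurableSet_cell
    fun q hq => h q.1 q.2.1 q.2.2 hq.2.2

lemma cellIntegral_add (hf : IsCont f) (hg : IsCont g) (ht : 0 ≤ t) :
    cellIntegral Lx Ly (fun t x y z => f t x y z + g t x y z) t
      = cellIntegral Lx Ly f t + cellIntegral Lx Ly g t :=
  integral_add (hf.integrableOn_cell ht) (hg.integrableOn_cell ht)

lemma cellIntegral_const_mul (c : ℝ) :
    cellIntegral Lx Ly (fun t x y z => c * f t x y z) t = c * cellIntegral Lx Ly f t :=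
  integral_const_mul _ _

/-- The integral over the cell of a function of height alone. -/
lemma cellIntegral_height (hLx : 0 ≤ Lx) (hLy : 0 ≤ Ly) (ψ : ℝ → ℝ) :
    cellIntegral Lx Ly (fun _ _ _ z => ψ z) t = Lx * Ly * ∫ z in Icc (0 : ℝ) 1, ψ z := by
  have h1 := setIntegral_prod_mul (μ := (volume : Measure ℝ)) (ν := (volume : Measure (ℝ × ℝ)))
    (fun _ : ℝ => (1 : ℝ)) (fun q : ℝ × ℝ => ψ q.2) (Icc 0 Lx) (Icc 0 Ly ×ˢ Icc 0 1)
  have h2 := setIntegral_prod_mul (μ := (volume : Measure ℝ)) (ν := (volume : Measure ℝ))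
    (fun _ : ℝ => (1 : ℝ)) ψ (Icc 0 Ly) (Icc 0 1)
  simp only [one_mul, ← Measure.volume_eq_prod] at h1 h2
  rw [cellIntegral, cell, h1, h2]
  simp [hLx, hLy]
  ring

/-- The space-time integral of a function of height alone. -/
lemma spaceTimeIntegral_height (hLx : 0 ≤ Lx) (hLy : 0 ≤ Ly) (hτ : 0 ≤ τ) (ψ : ℝ → ℝ) :
    spaceTimeIntegral Lx Ly τ (fun _ _ _ z => ψ z)
      = τ * (Lx * Ly) * ∫ z in Icc (0 : ℝ) 1, ψ z := by
  have h1 := setIntegral_prod_mul (μ := (volume : Measure ℝ))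
    (ν := (volume : Measure (ℝ × ℝ × ℝ)))
    (fun _ : ℝ => (1 : ℝ)) (fun q : ℝ × ℝ × ℝ => ψ q.2.2) (Icc 0 τ) (cell Lx Ly)
  have h2 := cellIntegral_height (t := 0) hLx hLy ψ
  simp only [one_mul, ← Measure.volume_eq_prod] at h1
  rw [cellIntegral] at h2
  rw [spaceTimeIntegral, h1, h2]
  simp [hτ]
  ring

lemma spaceTimeIntegral_const (hLx : 0 ≤ Lx) (hLy : 0 ≤ Ly) (hτ : 0 ≤ τ) (c : ℝ) :
    spaceTimeIntegral Lx Ly τ (fun _ _ _ _ => c) = τ * (Lx * Ly) * c := by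
  simpa using spaceTimeIntegral_height hLx hLy hτ (fun _ => c)

lemma cellIntegral_const (hLx : 0 ≤ Lx) (hLy : 0 ≤ Ly) (c : ℝ) :
    cellIntegral Lx Ly (fun _ _ _ _ => c) t = Lx * Ly * c := by
  simpa using cellIntegral_height (t := t) hLx hLy (fun _ => c)

lemma spaceTimeIntegral_eq_integral_cellIntegral (hf : IsCont f) :
    spaceTimeIntegral Lx Ly τ f = ∫ t in Icc 0 τ, cellIntegral Lx Ly f t :=
  setIntegral_prod_of_continuousOn isCompact_Icc isCompact_cell hf.continuousOn_spaceTime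

lemma spaceTimeIntegral_of_dt {a : ScalarField} (hτ : 0 ≤ τ) (hf : IsCont f) (ha : IsCont a)
    (h : ∀ t x y z : ℝ, 0 ≤ t → z ∈ Icc (0 : ℝ) 1 →
      HasDerivWithinAt (fun s => f s x y z) (a t x y z) (Ici 0) t) :
    spaceTimeIntegral Lx Ly τ a = cellIntegral Lx Ly f τ - cellIntegral Lx Ly f 0 := by
  rw [spaceTimeIntegral, setIntegral_prod_symm_of_continuousOn isCompact_Icc isCompact_cell
    ha.continuousOn_spaceTime, cellIntegral, cellIntegral,
    ← integral_sub (hf.integrableOn_cell hτ) (hf.integrableOn_cell le_rfl)]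
  refine setIntegral_congr_fun measurableSet_cell fun q hq => ?_
  refine setIntegral_Icc_eq_sub (F := fun s => f s q.1 q.2.1 q.2.2) hτ
    (fun t ht => (h t _ _ _ ht.1 hq.2.2).mono Icc_subset_Ici_self) ?_
  exact ContinuousOn.comp ha (by fun_prop) fun t ht => mem_domain ht.1 hq.2.2

lemma spaceTimeIntegral_of_dx {a : ScalarField} (hLx : 0 ≤ Lx) (ha : IsCont a)
    (h : ∀ t x y z : ℝ, 0 ≤ t → z ∈ Icc (0 : ℝ) 1 →
      HasDerivAt (fun s => f t s y z) (a t x y z) x)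
    (hper : ∀ t y z : ℝ, 0 ≤ t → z ∈ Icc (0 : ℝ) 1 → f t Lx y z = f t 0 y z) :
    spaceTimeIntegral Lx Ly τ a = 0 := by
  rw [spaceTimeIntegral_eq_integral_cellIntegral ha]
  refine setIntegral_eq_zero_of_forall_eq_zero fun t ht => ?_
  rw [cellIntegral, cell, setIntegral_prod_symm_of_continuousOn isCompact_Icc
    (isCompact_Icc.prod isCompact_Icc) (ha.continuousOn_cell ht.1)]
  refine setIntegral_eq_zero_of_forall_eq_zero fun q hq => ?_
  rw [setIntegral_Icc_eq_sub (F := fun s => f t s q.1 q.2) hLx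
    (fun x _ => (h t _ _ _ ht.1 hq.2).hasDerivWithinAt) ?_]
  · exact sub_eq_zero.2 (hper t _ _ ht.1 hq.2)
  · exact ContinuousOn.comp ha (by fun_prop) fun x _ => mem_domain ht.1 hq.2

lemma spaceTimeIntegral_of_dy {a : ScalarField} (hLy : 0 ≤ Ly) (ha : IsCont a)
    (h : ∀ t x y z : ℝ, 0 ≤ t → z ∈ Icc (0 : ℝ) 1 →
      HasDerivAt (fun s => f t x s z) (a t x y z) y)
    (hper : ∀ t x z : ℝ, 0 ≤ t → z ∈ Icc (0 : ℝ) 1 → f t x Ly z = f t x 0 z) :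
    spaceTimeIntegral Lx Ly τ a = 0 := by
  rw [spaceTimeIntegral_eq_integral_cellIntegral ha]
  refine setIntegral_eq_zero_of_forall_eq_zero fun t ht => ?_
  rw [cellIntegral, cell, setIntegral_prod_of_continuousOn isCompact_Icc
    (isCompact_Icc.prod isCompact_Icc) (ha.continuousOn_cell ht.1)]
  refine setIntegral_eq_zero_of_forall_eq_zero fun x hx => ?_
  rw [setIntegral_prod_symm_of_continuousOn isCompact_Icc isCompact_Icc
    (continuousOn_slice (ha.continuousOn_cell ht.1) hx)]
  refine setIntegral_eq_zero_of_forall_eq_zero fun z hz => ?_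
  rw [setIntegral_Icc_eq_sub (F := fun s => f t x s z) hLy
    (fun y _ => (h t _ _ _ ht.1 hz).hasDerivWithinAt) ?_]
  · exact sub_eq_zero.2 (hper t _ _ ht.1 hz)
  · exact ContinuousOn.comp ha (by fun_prop) fun y _ => mem_domain ht.1 hz

lemma spaceTimeIntegral_of_dz {a : ScalarField} (ha : IsCont a)
    (h : ∀ t x y z : ℝ, 0 ≤ t → z ∈ Icc (0 : ℝ) 1 →
      HasDerivWithinAt (fun s => f t x y s) (a t x y z) (Icc 0 1) z) :
    spaceTimeIntegral Lx Ly τ a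
      = plateIntegral Lx Ly τ (fun t x y => f t x y 1 - f t x y 0) := by
  rw [spaceTimeIntegral_eq_integral_cellIntegral ha, plateIntegral]
  refine setIntegral_congr_fun measurableSet_Icc fun t ht => ?_
  rw [cellIntegral, cell, setIntegral_prod_of_continuousOn isCompact_Icc
    (isCompact_Icc.prod isCompact_Icc) (ha.continuousOn_cell ht.1)]
  refine setIntegral_congr_fun measurableSet_Icc fun x hx => ?_
  simp only
  rw [setIntegral_prod_of_continuousOn isCompact_Icc isCompact_Icc
    (continuousOn_slice (ha.continuousOn_cell ht.1) hx)]
  refine setIntegral_congr_fun measurableSet_Icc fun y hy => ?_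
  refine setIntegral_Icc_eq_sub (F := fun s => f t x y s) zero_le_one
    (fun z hz => h t _ _ _ ht.1 hz) ?_
  exact ContinuousOn.comp ha (by fun_prop) fun z hz => mem_domain ht.1 hz

lemma plateIntegral_congr {g₁ g₂ : ℝ → ℝ → ℝ → ℝ}
    (h : ∀ t x y : ℝ, 0 ≤ t → g₁ t x y = g₂ t x y) :
    plateIntegral Lx Ly τ g₁ = plateIntegral Lx Ly τ g₂ :=
  setIntegral_congr_fun measurableSet_Icc fun t ht => by simp only [h t _ _ ht.1]

/-- **Balance law.** If `∂ₜ A = ∂ₓ X + ∂_y Y + ∂_z Z + S` with `X` and `Y` periodic, then the change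
of the integral of `A` over the cell is the space-time integral of the source `S` plus the flux of
`Z` through the plates. -/
lemma balance_law {A X Y Z a X' Y' Z' S : ScalarField} (hLx : 0 ≤ Lx) (hLy : 0 ≤ Ly) (hτ : 0 ≤ τ)
    (hA : IsCont A) (ha : IsCont a) (hX' : IsCont X') (hY' : IsCont Y') (hZ' : IsCont Z')
    (hS : IsCont S)
    (dA : ∀ t x y z : ℝ, 0 ≤ t → z ∈ Icc (0 : ℝ) 1 →
      HasDerivWithinAt (fun s => A s x y z) (a t x y z) (Ici 0) t)
    (dX : ∀ t x y z : ℝ, 0 ≤ t → z ∈ Icc (0 : ℝ) 1 →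
      HasDerivAt (fun s => X t s y z) (X' t x y z) x)
    (dY : ∀ t x y z : ℝ, 0 ≤ t → z ∈ Icc (0 : ℝ) 1 →
      HasDerivAt (fun s => Y t x s z) (Y' t x y z) y)
    (dZ : ∀ t x y z : ℝ, 0 ≤ t → z ∈ Icc (0 : ℝ) 1 →
      HasDerivWithinAt (fun s => Z t x y s) (Z' t x y z) (Icc 0 1) z)
    (perX : ∀ t y z : ℝ, 0 ≤ t → z ∈ Icc (0 : ℝ) 1 → X t Lx y z = X t 0 y z)
    (perY : ∀ t x z : ℝ, 0 ≤ t → z ∈ Icc (0 : ℝ) 1 → Y t x Ly z = Y t x 0 z)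
    (h : ∀ t x y z : ℝ, 0 ≤ t → z ∈ Icc (0 : ℝ) 1 →
      a t x y z = X' t x y z + Y' t x y z + Z' t x y z + S t x y z) :
    cellIntegral Lx Ly A τ - cellIntegral Lx Ly A 0 = spaceTimeIntegral Lx Ly τ S
      + plateIntegral Lx Ly τ (fun t x y => Z t x y 1 - Z t x y 0) := by
  rw [← spaceTimeIntegral_of_dt hτ hA ha dA, spaceTimeIntegral_congr h,
    spaceTimeIntegral_add ((hX'.add hY').add hZ') hS,
    spaceTimeIntegral_add (hX'.add hY') hZ', spaceTimeIntegral_add hX' hY',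
    spaceTimeIntegral_of_dx hLx hX' dX perX, spaceTimeIntegral_of_dy hLy hY' dY perY,
    spaceTimeIntegral_of_dz hZ' dZ]
  ring

/-! ### Comparison with the averages in the statement -/

lemma integral_volumeAverage (hLx : 0 ≤ Lx) (hLy : 0 ≤ Ly) (hτ : 0 ≤ τ) (hf : IsCont f) :
    ∫ t in (0 : ℝ)..τ, volumeAverage Lx Ly f t
      = 1 / (Lx * Ly) * spaceTimeIntegral Lx Ly τ f := by
  rw [intervalIntegral.integral_of_le hτ, ← integral_Icc_eq_integral_Ioc,
    spaceTimeIntegral_eq_integral_cellIntegral hf, ← integral_const_mul]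
  refine setIntegral_congr_fun measurableSet_Icc fun t ht => ?_
  simp only [volumeAverage, horizontalAverage]
  rw [intervalIntegral.integral_const_mul]
  congr 1
  have hc := hf.continuousOn_cell (Lx := Lx) (Ly := Ly) ht.1
  have hmp := volume_preserving_prodAssoc (α₁ := ℝ) (β₁ := ℝ) (γ₁ := ℝ)
  have hpre : (MeasurableEquiv.prodAssoc : (ℝ × ℝ) × ℝ ≃ᵐ ℝ × ℝ × ℝ) ⁻¹' cell Lx Ly
      = (Icc 0 Lx ×ˢ Icc 0 Ly) ×ˢ Icc 0 1 := by
    ext ⟨⟨x, y⟩, z⟩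
    simp [cell, and_assoc, MeasurableEquiv.prodAssoc]
  have hc' : ContinuousOn (fun q : (ℝ × ℝ) × ℝ => f t q.1.1 q.1.2 q.2)
      ((Icc 0 Lx ×ˢ Icc 0 Ly) ×ˢ Icc 0 1) :=
    hc.comp (by fun_prop : Continuous fun q : (ℝ × ℝ) × ℝ => (q.1.1, q.1.2, q.2)).continuousOn
      fun q hq => ⟨hq.1.1, hq.1.2, hq.2⟩
  have h1 : cellIntegral Lx Ly f t
      = ∫ q in (Icc 0 Lx ×ˢ Icc 0 Ly) ×ˢ Icc 0 1, f t q.1.1 q.1.2 q.2 := by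
    rw [cellIntegral, ← hmp.setIntegral_preimage_emb
      (MeasurableEquiv.measurableEmbedding _), hpre]
    rfl
  rw [h1, setIntegral_prod_symm_of_continuousOn (isCompact_Icc.prod isCompact_Icc) isCompact_Icc
    hc', intervalIntegral.integral_of_le zero_le_one, ← integral_Icc_eq_integral_Ioc]
  refine setIntegral_congr_fun measurableSet_Icc fun z hz => ?_
  simp only
  have hz' : ContinuousOn (fun q : ℝ × ℝ => f t q.1 q.2 z) (Icc 0 Lx ×ˢ Icc 0 Ly) :=
    hc'.comp (by fun_prop : Continuous fun q : ℝ × ℝ => (q, z)).continuousOn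
      fun q hq => ⟨hq, hz⟩
  rw [setIntegral_prod_of_continuousOn isCompact_Icc isCompact_Icc hz',
    intervalIntegral.integral_of_le hLx, ← integral_Icc_eq_integral_Ioc]
  refine setIntegral_congr_fun measurableSet_Icc fun x hx => ?_
  simp only
  rw [intervalIntegral.integral_of_le hLy, ← integral_Icc_eq_integral_Ioc]

lemma integral_horizontalAverage (hLx : 0 ≤ Lx) (hLy : 0 ≤ Ly) (hτ : 0 ≤ τ) (z : ℝ) :
    ∫ t in (0 : ℝ)..τ, horizontalAverage Lx Ly f t z
      = 1 / (Lx * Ly) * plateIntegral Lx Ly τ (fun t x y => f t x y z) := by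
  simp only [horizontalAverage, plateIntegral, intervalIntegral.integral_of_le hτ,
    intervalIntegral.integral_of_le hLx, intervalIntegral.integral_of_le hLy,
    integral_Icc_eq_integral_Ioc]
  rw [integral_const_mul]

end Integrals

/-! ### Integral identities for solutions -/

section Identities

variable {R Lx Ly τ : ℝ} {u v w p T : ScalarField}

/-- Mechanical energy balance: viscous dissipation equals the work of buoyancy. Only the part of
the dissipation due to `∂_z w` is kept. -/
lemma dissipation_le (hLx : 0 ≤ Lx) (hLy : 0 ≤ Ly) (hτ : 0 ≤ τ)
    (h : IsStressFreeSolution R Lx Ly u v w p T) :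
    spaceTimeIntegral Lx Ly τ (fun t x y z => dz w t x y z ^ 2)
      ≤ R * spaceTimeIntegral Lx Ly τ (fun t x y z => w t x y z * T t x y z) := by
  have hu1 : IsOfClass 1 u := h.regular_u.of_le one_le_two
  have hv1 : IsOfClass 1 v := h.regular_v.of_le one_le_two
  have hw1 : IsOfClass 1 w := h.regular_w.of_le one_le_two
  have hp1 : IsOfClass 1 p := h.regular_p
  have hux := h.regular_u.dx
  have huy := h.regular_u.dy
  have huz := h.regular_u.dz
  have hvx := h.regular_v.dx
  have hvy := h.regular_v.dy
  have hvz := h.regular_v.dz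
  have hwx := h.regular_w.dx
  have hwy := h.regular_w.dy
  have hwz := h.regular_w.dz
  have cu := hu1.isCont
  have cv := hv1.isCont
  have cw := hw1.isCont
  have cp := hp1.isCont
  have cT := h.regular_T.isCont
  have cux := hux.isCont
  have cuy := huy.isCont
  have cuz := huz.isCont
  have cvx := hvx.isCont
  have cvy := hvy.isCont
  have cvz := hvz.isCont
  have cwx := hwx.isCont
  have cwy := hwy.isCont
  have cwz := hwz.isCont
  -- `G` is the squared velocity gradient; the balance law is used with zero density.
  set G : ScalarField := fun t x y z =>
    (dx u t x y z ^ 2 + dy u t x y z ^ 2 + dz u t x y z ^ 2)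
      + (dx v t x y z ^ 2 + dy v t x y z ^ 2 + dz v t x y z ^ 2)
      + (dx w t x y z ^ 2 + dy w t x y z ^ 2 + dz w t x y z ^ 2) with hG
  have cG : IsCont G :=
    ((((cux.pow 2).add (cuy.pow 2)).add (cuz.pow 2)).add
      (((cvx.pow 2).add (cvy.pow 2)).add (cvz.pow 2))).add
      (((cwx.pow 2).add (cwy.pow 2)).add (cwz.pow 2))
  have cRwT : IsCont fun t x y z => R * (w t x y z * T t x y z) :=
    (isCont_const R).mul (cw.mul cT)
  have key := balance_law (A := fun _ _ _ _ => 0) (a := fun _ _ _ _ => 0) (Lx := Lx) (Ly := Ly)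
    (X := fun t x y z => u t x y z * dx u t x y z + v t x y z * dx v t x y z
      + w t x y z * dx w t x y z - u t x y z * p t x y z)
    (Y := fun t x y z => u t x y z * dy u t x y z + v t x y z * dy v t x y z
      + w t x y z * dy w t x y z - v t x y z * p t x y z)
    (Z := fun t x y z => u t x y z * dz u t x y z + v t x y z * dz v t x y z
      + w t x y z * dz w t x y z - w t x y z * p t x y z)
    (S := fun t x y z => R * (w t x y z * T t x y z) - G t x y z)
    hLx hLy hτ (isCont_const 0) (isCont_const 0)
    (((((cux.mul cux).add (cu.mul hux.dx.isCont)).add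
      ((cvx.mul cvx).add (cv.mul hvx.dx.isCont))).add
      ((cwx.mul cwx).add (cw.mul hwx.dx.isCont))).sub ((cux.mul cp).add (cu.mul hp1.dx.isCont)))
    (((((cuy.mul cuy).add (cu.mul huy.dy.isCont)).add
      ((cvy.mul cvy).add (cv.mul hvy.dy.isCont))).add
      ((cwy.mul cwy).add (cw.mul hwy.dy.isCont))).sub ((cvy.mul cp).add (cv.mul hp1.dy.isCont)))
    (((((cuz.mul cuz).add (cu.mul huz.dz.isCont)).add
      ((cvz.mul cvz).add (cv.mul hvz.dz.isCont))).add
      ((cwz.mul cwz).add (cw.mul hwz.dz.isCont))).sub ((cwz.mul cp).add (cw.mul hp1.dz.isCont)))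
    (cRwT.sub cG)
    (fun t x y z _ _ => hasDerivWithinAt_const _ _ _)
    (fun t x y z ht hz => ((((hu1.hasDerivAt_dx ht hz).mul (hux.hasDerivAt_dx ht hz)).add
      ((hv1.hasDerivAt_dx ht hz).mul (hvx.hasDerivAt_dx ht hz))).add
      ((hw1.hasDerivAt_dx ht hz).mul (hwx.hasDerivAt_dx ht hz))).sub
      ((hu1.hasDerivAt_dx ht hz).mul (hp1.hasDerivAt_dx ht hz)))
    (fun t x y z ht hz => ((((hu1.hasDerivAt_dy ht hz).mul (huy.hasDerivAt_dy ht hz)).add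
      ((hv1.hasDerivAt_dy ht hz).mul (hvy.hasDerivAt_dy ht hz))).add
      ((hw1.hasDerivAt_dy ht hz).mul (hwy.hasDerivAt_dy ht hz))).sub
      ((hv1.hasDerivAt_dy ht hz).mul (hp1.hasDerivAt_dy ht hz)))
    (fun t x y z ht hz => ((((hu1.hasDerivWithinAt_dz ht hz).mul
      (huz.hasDerivWithinAt_dz ht hz)).add
      ((hv1.hasDerivWithinAt_dz ht hz).mul (hvz.hasDerivWithinAt_dz ht hz))).add
      ((hw1.hasDerivWithinAt_dz ht hz).mul (hwz.hasDerivWithinAt_dz ht hz))).sub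
      ((hw1.hasDerivWithinAt_dz ht hz).mul (hp1.hasDerivWithinAt_dz ht hz)))
    (fun t y z ht hz => by
      simp only [h.periodic_u.at_Lx ht hz, h.periodic_v.at_Lx ht hz, h.periodic_w.at_Lx ht hz,
        h.periodic_p.at_Lx ht hz, h.periodic_u.dx_at_Lx ht hz, h.periodic_v.dx_at_Lx ht hz,
        h.periodic_w.dx_at_Lx ht hz])
    (fun t x z ht hz => by
      simp only [h.periodic_u.at_Ly ht hz, h.periodic_v.at_Ly ht hz, h.periodic_w.at_Ly ht hz,
        h.periodic_p.at_Ly ht hz, h.periodic_u.dy_at_Ly ht hz, h.periodic_v.dy_at_Ly ht hz,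
        h.periodic_w.dy_at_Ly ht hz])
    (fun t x y z ht hz => by
      have e1 := h.momentum_x t x y z ht hz
      have e2 := h.momentum_y t x y z ht hz
      have e3 := h.momentum_z t x y z ht hz
      have e4 := h.incompressible t x y z ht hz
      simp only [laplacian] at e1 e2 e3
      simp only [hG]
      linear_combination u t x y z * e1 + v t x y z * e2 + w t x y z * e3 + p t x y z * e4)
  have hplate : plateIntegral Lx Ly τ (fun t x y =>
      (u t x y 1 * dz u t x y 1 + v t x y 1 * dz v t x y 1 + w t x y 1 * dz w t x y 1
        - w t x y 1 * p t x y 1)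
      - (u t x y 0 * dz u t x y 0 + v t x y 0 * dz v t x y 0 + w t x y 0 * dz w t x y 0
        - w t x y 0 * p t x y 0)) = 0 := by
    rw [plateIntegral_congr (g₂ := fun _ _ _ => 0) fun t x y ht => by
      simp [h.bc_u t x y _ ht (Or.inl rfl), h.bc_u t x y _ ht (Or.inr rfl),
        h.bc_v t x y _ ht (Or.inl rfl), h.bc_v t x y _ ht (Or.inr rfl),
        h.bc_w t x y _ ht (Or.inl rfl), h.bc_w t x y _ ht (Or.inr rfl)]]
    simp [plateIntegral]
  rw [hplate, spaceTimeIntegral_sub cRwT cG, spaceTimeIntegral_const_mul] at key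
  have hle : spaceTimeIntegral Lx Ly τ (fun t x y z => dz w t x y z ^ 2)
      ≤ spaceTimeIntegral Lx Ly τ G :=
    spaceTimeIntegral_mono (cwz.pow 2) cG fun t x y z _ _ => by simp only [hG]; nlinarith
  simp only [cellIntegral, integral_zero] at key
  linarith

/-- Balance of `ψ(z) φ(T)`, for `φ` of class `C²` with `φ(0) = 0` and `ψ` of class `C²`. -/
lemma temperature_balance (hLx : 0 ≤ Lx) (hLy : 0 ≤ Ly) (hτ : 0 ≤ τ)
    (h : IsStressFreeSolution R Lx Ly u v w p T) {φ φ₁ φ₂ ψ ψ₁ ψ₂ : ℝ → ℝ}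
    (hφ : ∀ s, HasDerivAt φ (φ₁ s) s) (hφ₁ : ∀ s, HasDerivAt φ₁ (φ₂ s) s) (hφ₂ : Continuous φ₂)
    (hφ0 : φ 0 = 0)
    (hψ : ∀ s, HasDerivAt ψ (ψ₁ s) s) (hψ₁ : ∀ s, HasDerivAt ψ₁ (ψ₂ s) s) (hψ₂ : Continuous ψ₂) :
    cellIntegral Lx Ly (fun t x y z => ψ z * φ (T t x y z)) τ
        - cellIntegral Lx Ly (fun t x y z => ψ z * φ (T t x y z)) 0
      = spaceTimeIntegral Lx Ly τ (fun t x y z => ψ z * φ₁ (T t x y z) + ψ₂ z * φ (T t x y z)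
          + ψ₁ z * (w t x y z * φ (T t x y z))
          - ψ z * (φ₂ (T t x y z)
            * (dx T t x y z ^ 2 + dy T t x y z ^ 2 + dz T t x y z ^ 2)))
        + plateIntegral Lx Ly τ
          (fun t x y => φ₁ 0 * (ψ 1 * dz T t x y 1 - ψ 0 * dz T t x y 0)) := by
  have hu1 : IsOfClass 1 u := h.regular_u.of_le one_le_two
  have hv1 : IsOfClass 1 v := h.regular_v.of_le one_le_two
  have hw1 : IsOfClass 1 w := h.regular_w.of_le one_le_two
  have hT1 : IsOfClass 1 T := h.regular_T.of_le one_le_two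
  have hTx := h.regular_T.dx
  have hTy := h.regular_T.dy
  have hTz := h.regular_T.dz
  have cφ : Continuous φ := continuous_iff_continuousAt.2 fun s => (hφ s).continuousAt
  have cφ₁ : Continuous φ₁ := continuous_iff_continuousAt.2 fun s => (hφ₁ s).continuousAt
  have cψ : Continuous ψ := continuous_iff_continuousAt.2 fun s => (hψ s).continuousAt
  have cψ₁ : Continuous ψ₁ := continuous_iff_continuousAt.2 fun s => (hψ₁ s).continuousAt
  have cT := hT1.isCont
  have fT : IsCont fun t x y z => φ (T t x y z) := cT.comp cφ
  have f₁T : IsCont fun t x y z => φ₁ (T t x y z) := cT.comp cφ₁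
  have f₂T : IsCont fun t x y z => φ₂ (T t x y z) := cT.comp hφ₂
  have gψ : IsCont fun _ _ _ z => ψ z := isCont_height cψ
  have gψ₁ : IsCont fun _ _ _ z => ψ₁ z := isCont_height cψ₁
  have gψ₂ : IsCont fun _ _ _ z => ψ₂ z := isCont_height hψ₂
  have cu := hu1.isCont
  have cv := hv1.isCont
  have cw := hw1.isCont
  have cTx := hTx.isCont
  have cTy := hTy.isCont
  have cTz := hTz.isCont
  have key := balance_law (Lx := Lx) (Ly := Ly)
    (A := fun t x y z => ψ z * φ (T t x y z))
    (a := fun t x y z => ψ z * (φ₁ (T t x y z) * dt T t x y z))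
    (X := fun t x y z => ψ z * (φ₁ (T t x y z) * dx T t x y z - u t x y z * φ (T t x y z)))
    (X' := fun t x y z => ψ z * ((φ₂ (T t x y z) * dx T t x y z * dx T t x y z
        + φ₁ (T t x y z) * dx (dx T) t x y z)
      - (dx u t x y z * φ (T t x y z) + u t x y z * (φ₁ (T t x y z) * dx T t x y z))))
    (Y := fun t x y z => ψ z * (φ₁ (T t x y z) * dy T t x y z - v t x y z * φ (T t x y z)))
    (Y' := fun t x y z => ψ z * ((φ₂ (T t x y z) * dy T t x y z * dy T t x y z
        + φ₁ (T t x y z) * dy (dy T) t x y z)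
      - (dy v t x y z * φ (T t x y z) + v t x y z * (φ₁ (T t x y z) * dy T t x y z))))
    (Z := fun t x y z => ψ z * (φ₁ (T t x y z) * dz T t x y z - w t x y z * φ (T t x y z))
      - ψ₁ z * φ (T t x y z))
    (Z' := fun t x y z => (ψ₁ z * (φ₁ (T t x y z) * dz T t x y z - w t x y z * φ (T t x y z))
      + ψ z * ((φ₂ (T t x y z) * dz T t x y z * dz T t x y z
        + φ₁ (T t x y z) * dz (dz T) t x y z)
      - (dz w t x y z * φ (T t x y z) + w t x y z * (φ₁ (T t x y z) * dz T t x y z))))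
      - (ψ₂ z * φ (T t x y z) + ψ₁ z * (φ₁ (T t x y z) * dz T t x y z)))
    (S := fun t x y z => ψ z * φ₁ (T t x y z) + ψ₂ z * φ (T t x y z)
      + ψ₁ z * (w t x y z * φ (T t x y z))
      - ψ z * (φ₂ (T t x y z) * (dx T t x y z ^ 2 + dy T t x y z ^ 2 + dz T t x y z ^ 2)))
    hLx hLy hτ (gψ.mul fT) (gψ.mul (f₁T.mul h.regular_T.dt.isCont))
    (gψ.mul ((((f₂T.mul cTx).mul cTx).add (f₁T.mul hTx.dx.isCont)).sub
      ((h.regular_u.dx.isCont.mul fT).add (cu.mul (f₁T.mul cTx)))))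
    (gψ.mul ((((f₂T.mul cTy).mul cTy).add (f₁T.mul hTy.dy.isCont)).sub
      ((h.regular_v.dy.isCont.mul fT).add (cv.mul (f₁T.mul cTy)))))
    (((gψ₁.mul ((f₁T.mul cTz).sub (cw.mul fT))).add
      (gψ.mul ((((f₂T.mul cTz).mul cTz).add (f₁T.mul hTz.dz.isCont)).sub
      ((h.regular_w.dz.isCont.mul fT).add (cw.mul (f₁T.mul cTz)))))).sub
      ((gψ₂.mul fT).add (gψ₁.mul (f₁T.mul cTz))))
    ((((gψ.mul f₁T).add (gψ₂.mul fT)).add (gψ₁.mul (cw.mul fT))).sub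
      (gψ.mul (f₂T.mul (((cTx.pow 2).add (cTy.pow 2)).add (cTz.pow 2)))))
    (fun t x y z ht hz =>
      ((hφ _).comp_hasDerivWithinAt t (hT1.hasDerivWithinAt_dt ht hz)).const_mul _)
    (fun t x y z ht hz => ((((hφ₁ _).comp x (hT1.hasDerivAt_dx ht hz)).mul
      (hTx.hasDerivAt_dx ht hz)).sub ((hu1.hasDerivAt_dx ht hz).mul
      ((hφ _).comp x (hT1.hasDerivAt_dx ht hz)))).const_mul _)
    (fun t x y z ht hz => ((((hφ₁ _).comp y (hT1.hasDerivAt_dy ht hz)).mul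
      (hTy.hasDerivAt_dy ht hz)).sub ((hv1.hasDerivAt_dy ht hz).mul
      ((hφ _).comp y (hT1.hasDerivAt_dy ht hz)))).const_mul _)
    (fun t x y z ht hz => ((hψ z).hasDerivWithinAt.mul
      ((((hφ₁ _).comp_hasDerivWithinAt z (hT1.hasDerivWithinAt_dz ht hz)).mul
      (hTz.hasDerivWithinAt_dz ht hz)).sub ((hw1.hasDerivWithinAt_dz ht hz).mul
      ((hφ _).comp_hasDerivWithinAt z (hT1.hasDerivWithinAt_dz ht hz))))).sub
      ((hψ₁ z).hasDerivWithinAt.mul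
        ((hφ _).comp_hasDerivWithinAt z (hT1.hasDerivWithinAt_dz ht hz))))
    (fun t y z ht hz => by
      simp only [h.periodic_u.at_Lx ht hz, h.periodic_T.at_Lx ht hz, h.periodic_T.dx_at_Lx ht hz])
    (fun t x z ht hz => by
      simp only [h.periodic_v.at_Ly ht hz, h.periodic_T.at_Ly ht hz, h.periodic_T.dy_at_Ly ht hz])
    (fun t x y z ht hz => by
      have e1 := h.heat t x y z ht hz
      have e2 := h.incompressible t x y z ht hz
      simp only [laplacian] at e1
      linear_combination ψ z * φ₁ (T t x y z) * e1 + ψ z * φ (T t x y z) * e2)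
  rw [key]
  congr 1
  refine plateIntegral_congr fun t x y ht => ?_
  simp only [h.bc_T t x y _ ht (Or.inl rfl), h.bc_T t x y _ ht (Or.inr rfl),
    h.bc_w t x y _ ht (Or.inl rfl), h.bc_w t x y _ ht (Or.inr rfl), hφ0]
  ring

/-- A Hardy inequality with a weight concentrated at the bottom plate. It comes from integrating
`∂_z ((1 - z)^(k+1) g²)`, whose boundary values vanish. -/
lemma weighted_hardy {g g' : ScalarField} (hg : IsCont g) (hg' : IsCont g')
    (dg : ∀ t x y z : ℝ, 0 ≤ t → z ∈ Icc (0 : ℝ) 1 →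
      HasDerivWithinAt (fun s => g t x y s) (g' t x y z) (Icc 0 1) z)
    (g0 : ∀ t x y : ℝ, 0 ≤ t → g t x y 0 = 0) (k : ℕ) :
    (k + 1) ^ 2 * spaceTimeIntegral Lx Ly τ (fun t x y z => (1 - z) ^ k * g t x y z ^ 2)
      ≤ 4 * spaceTimeIntegral Lx Ly τ (fun t x y z => g' t x y z ^ 2) := by
  have c1 (m : ℕ) : IsCont fun _ _ _ z => (1 - z) ^ m := isCont_height (by fun_prop)
  have hz := spaceTimeIntegral_of_dz (Lx := Lx) (Ly := Ly) (τ := τ)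
    (f := fun t x y z => (1 - z) ^ (k + 1) * g t x y z ^ 2)
    (a := fun t x y z => 2 * ((1 - z) ^ (k + 1) * (g t x y z * g' t x y z))
      - (k + 1) * ((1 - z) ^ k * g t x y z ^ 2))
    (((isCont_const 2).mul ((c1 _).mul (hg.mul hg'))).sub
      ((isCont_const ((k : ℝ) + 1)).mul ((c1 k).mul (hg.pow 2))))
    (fun t x y z ht hz => by
      have h1 : HasDerivAt (fun s : ℝ => (1 - s) ^ (k + 1)) (-((k + 1) * (1 - z) ^ k)) z := by
        have : HasDerivAt (fun s : ℝ => (1 - s) ^ (k + 1)) _ z :=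
          ((hasDerivAt_id z).const_sub 1).pow (k + 1)
        exact this.congr_deriv (by simp)
      have h2 := h1.hasDerivWithinAt.mul ((dg t x y z ht hz).pow 2)
      refine h2.congr_deriv ?_
      simp only [Pi.pow_apply, Nat.cast_ofNat, Nat.add_one_sub_one, pow_one]
      ring)
  have hplate : plateIntegral Lx Ly τ (fun t x y => (1 - (1 : ℝ)) ^ (k + 1) * g t x y 1 ^ 2
      - (1 - (0 : ℝ)) ^ (k + 1) * g t x y 0 ^ 2) = 0 := by
    rw [plateIntegral_congr (g₂ := fun _ _ _ => 0) fun t x y ht => by simp [g0 t x y ht]]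
    simp [plateIntegral]
  rw [hplate] at hz
  rw [← spaceTimeIntegral_const_mul, ← spaceTimeIntegral_const_mul]
  have hle : spaceTimeIntegral Lx Ly τ (fun t x y z =>
      (k + 1) ^ 2 * ((1 - z) ^ k * g t x y z ^ 2))
      ≤ spaceTimeIntegral Lx Ly τ (fun t x y z => 4 * g' t x y z ^ 2
        - 2 * (k + 1) * (2 * ((1 - z) ^ (k + 1) * (g t x y z * g' t x y z))
      - (k + 1) * ((1 - z) ^ k * g t x y z ^ 2))) := by
    refine spaceTimeIntegral_mono ((isCont_const _).mul ((c1 k).mul (hg.pow 2)))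
      (((isCont_const 4).mul (hg'.pow 2)).sub ((isCont_const _).mul
      (((isCont_const 2).mul ((c1 _).mul (hg.mul hg'))).sub
      ((isCont_const ((k : ℝ) + 1)).mul ((c1 k).mul (hg.pow 2)))))) fun t x y z _ hz => ?_
    have hs0 : 0 ≤ 1 - z := by linarith [hz.2]
    have hs1 : 1 - z ≤ 1 := by linarith [hz.1]
    have hk : 0 ≤ (1 - z) ^ k := pow_nonneg hs0 k
    have hk1 : (1 - z) ^ k ≤ 1 := pow_le_one₀ hs0 hs1
    -- completing the square in `(k + 1) g` and `2 (1 - z) g'`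
    have h1 := mul_nonneg hk (sq_nonneg ((k + 1) * g t x y z - 2 * ((1 - z) * g' t x y z)))
    have h2 : (1 - z) ^ k * (1 - z) ^ 2 ≤ 1 :=
      mul_le_one₀ hk1 (by positivity) (pow_le_one₀ hs0 hs1)
    have h3 := mul_le_mul_of_nonneg_right h2 (sq_nonneg (g' t x y z))
    have h4 : (1 - z) ^ (k + 1) = (1 - z) ^ k * (1 - z) := pow_succ _ _
    rw [h4]
    linarith
  rw [spaceTimeIntegral_sub ((isCont_const 4).mul (hg'.pow 2)) ((isCont_const _).mul
      (((isCont_const 2).mul ((c1 _).mul (hg.mul hg'))).sub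
      ((isCont_const ((k : ℝ) + 1)).mul ((c1 k).mul (hg.pow 2))))),
    spaceTimeIntegral_const_mul (2 * ((k : ℝ) + 1)), hz, mul_zero, sub_zero] at hle
  exact hle

end Identities

/-! ### A priori bounds on the temperature -/

/-- Powers of the negative part are differentiable, with the expected derivative. -/
lemma hasDerivAt_min_zero_pow (m : ℕ) (s : ℝ) :
    HasDerivAt (fun r : ℝ => min r 0 ^ (m + 2)) ((m + 2) * min s 0 ^ (m + 1)) s := by
  have hp (r : ℝ) : HasDerivAt (fun r : ℝ => r ^ (m + 2)) ((m + 2) * r ^ (m + 1)) r := by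
    simpa using hasDerivAt_pow (m + 2) r
  rcases lt_trichotomy s 0 with hs | rfl | hs
  · rw [min_eq_left hs.le]
    refine (hp s).congr_of_eventuallyEq ?_
    filter_upwards [Iio_mem_nhds hs] with r hr
    rw [min_eq_left (le_of_lt hr)]
  · rw [← hasDerivWithinAt_univ, ← Iic_union_Ici (a := (0 : ℝ))]
    refine HasDerivWithinAt.union ?_ ?_
    · rw [min_self]
      exact (hp 0).hasDerivWithinAt.congr (fun r hr => by rw [min_eq_left hr]) (by simp)
    · refine ((hasDerivWithinAt_const 0 (Ici 0) (0 : ℝ)).congr (fun r hr => ?_) ?_).congr_deriv ?_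
      · simp [min_eq_right (show (0 : ℝ) ≤ r from hr)]
      · simp
      · simp
  · rw [min_eq_right hs.le]
    refine ((hasDerivAt_const s (0 : ℝ)).congr_of_eventuallyEq ?_).congr_deriv (by simp)
    filter_upwards [Ioi_mem_nhds hs] with r hr
    rw [min_eq_right (le_of_lt hr)]
    simp

/-- Young's inequality in the form in which it is used to trade powers of the temperature. -/
lemma pow_le_add_pow_div {a r : ℝ} (ha : 0 ≤ a) (hr : 0 < r) (m n : ℕ) :
    a ^ m ≤ r ^ m + a ^ (m + n) / r ^ n := by
  rcases le_total a r with h | h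
  · have h1 : a ^ m ≤ r ^ m := by gcongr
    have h2 : 0 ≤ a ^ (m + n) / r ^ n := by positivity
    linarith
  · have h1 : a ^ m ≤ a ^ (m + n) / r ^ n := by
      rw [le_div_iff₀ (by positivity), pow_add]
      gcongr
    have h2 : 0 ≤ r ^ m := by positivity
    linarith

section Bounds

variable {R Lx Ly τ : ℝ} {u v w p T : ScalarField}

/-- The negative part of the temperature disappears in the long-time mean: the internal heat source
works against it. -/
lemma exists_negPart_le (hLx : 0 < Lx) (hLy : 0 < Ly)
    (h : IsStressFreeSolution R Lx Ly u v w p T) {ε : ℝ} (hε : 0 < ε) :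
    ∃ C, ∀ τ, 0 ≤ τ → spaceTimeIntegral Lx Ly τ (fun t x y z => -min (T t x y z) 0)
      ≤ ε * (τ * (Lx * Ly)) + C := by
  have cT := h.regular_T.isCont
  have cn (m : ℕ) : IsCont fun t x y z => min (T t x y z) 0 ^ m :=
    cT.comp (φ := fun s => min s 0 ^ m) (by fun_prop)
  have cn1 : IsCont fun t x y z => -min (T t x y z) 0 :=
    cT.comp (φ := fun s => -min s 0) (by fun_prop)
  have ccub : IsCont fun t x y z => (-min (T t x y z) 0) ^ 3 := cn1.pow 3
  refine ⟨1 / ε ^ 2 * cellIntegral Lx Ly (fun t x y z => min (T t x y z) 0 ^ 4) 0, fun τ hτ => ?_⟩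
  have key := temperature_balance hLx.le hLy.le hτ h (φ := fun s => min s 0 ^ 4)
    (φ₁ := fun s => 4 * min s 0 ^ 3) (φ₂ := fun s => 4 * (3 * min s 0 ^ 2))
    (ψ := fun _ => 1) (ψ₁ := fun _ => 0) (ψ₂ := fun _ => 0)
    (fun s => (hasDerivAt_min_zero_pow 2 s).congr_deriv (by norm_num))
    (fun s => ((hasDerivAt_min_zero_pow 1 s).const_mul 4).congr_deriv (by norm_num))
    (by fun_prop) (by simp) (fun s => hasDerivAt_const s 1) (fun s => hasDerivAt_const s 0)
    continuous_const
  have hplate : plateIntegral Lx Ly τ (fun t x y => 4 * min (0 : ℝ) 0 ^ 3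
      * (1 * dz T t x y 1 - 1 * dz T t x y 0)) = 0 := by
    simp [plateIntegral]
  rw [hplate, add_zero] at key
  simp only [one_mul, zero_mul, add_zero] at key
  have cgrad : IsCont fun t x y z => dx T t x y z ^ 2 + dy T t x y z ^ 2 + dz T t x y z ^ 2 :=
    ((h.regular_T.dx.isCont.pow 2).add (h.regular_T.dy.isCont.pow 2)).add
      (h.regular_T.dz.isCont.pow 2)
  have h1 : spaceTimeIntegral Lx Ly τ (fun t x y z => 4 * min (T t x y z) 0 ^ 3
      - 4 * (3 * min (T t x y z) 0 ^ 2)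
        * (dx T t x y z ^ 2 + dy T t x y z ^ 2 + dz T t x y z ^ 2))
      ≤ spaceTimeIntegral Lx Ly τ (fun t x y z => (-4) * (-min (T t x y z) 0) ^ 3) := by
    refine spaceTimeIntegral_mono (((isCont_const 4).mul (cn 3)).sub
      (((isCont_const 4).mul ((isCont_const 3).mul (cn 2))).mul cgrad))
      ((isCont_const _).mul ccub) fun t x y z _ _ => ?_
    have : 0 ≤ 4 * (3 * min (T t x y z) 0 ^ 2)
        * (dx T t x y z ^ 2 + dy T t x y z ^ 2 + dz T t x y z ^ 2) := by positivity
    linarith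
  rw [spaceTimeIntegral_const_mul] at h1
  have h2 : 0 ≤ cellIntegral Lx Ly (fun t x y z => min (T t x y z) 0 ^ 4) τ := by
    refine setIntegral_nonneg measurableSet_cell fun q _ => ?_
    positivity
  have h2' : 0 ≤ cellIntegral Lx Ly (fun t x y z => min (T t x y z) 0 ^ 4) 0 := by
    refine setIntegral_nonneg measurableSet_cell fun q _ => ?_
    positivity
  have h3 : spaceTimeIntegral Lx Ly τ (fun t x y z => -min (T t x y z) 0)
      ≤ spaceTimeIntegral Lx Ly τ (fun t x y z => ε + 1 / ε ^ 2 * (-min (T t x y z) 0) ^ 3) := by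
    refine spaceTimeIntegral_mono cn1 ((isCont_const ε).add ((isCont_const _).mul ccub))
      fun t x y z _ _ => ?_
    have := pow_le_add_pow_div (a := -min (T t x y z) 0) (by simp) hε 1 2
    rw [pow_one, pow_one] at this
    refine this.trans (le_of_eq ?_)
    ring
  rw [spaceTimeIntegral_add (isCont_const ε) ((isCont_const _).mul ccub),
    spaceTimeIntegral_const_mul, spaceTimeIntegral_const hLx.le hLy.le hτ] at h3
  have h4 : spaceTimeIntegral Lx Ly τ (fun t x y z => (-min (T t x y z) 0) ^ 3)
      ≤ cellIntegral Lx Ly (fun t x y z => min (T t x y z) 0 ^ 4) 0 := by linarith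
  have h5 := mul_le_mul_of_nonneg_left h4 (by positivity : 0 ≤ 1 / ε ^ 2)
  linarith

/-- A bound on the sixteenth moment of the temperature that does not depend on the Rayleigh number:
the flow drops out of the balance of any function of the temperature. -/
lemma moment_bound (hLx : 0 < Lx) (hLy : 0 < Ly) (hτ : 0 ≤ τ)
    (h : IsStressFreeSolution R Lx Ly u v w p T) :
    cellIntegral Lx Ly (fun t x y z => T t x y z ^ 16) τ
        + 7 / 16 * spaceTimeIntegral Lx Ly τ (fun t x y z => T t x y z ^ 16)
      ≤ cellIntegral Lx Ly (fun t x y z => T t x y z ^ 16) 0 + 2 ^ 79 * (τ * (Lx * Ly)) := by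
  have cT := h.regular_T.isCont
  have hT1 : IsOfClass 1 T := h.regular_T.of_le one_le_two
  have cTz := h.regular_T.dz.isCont
  have key := temperature_balance hLx.le hLy.le hτ h (φ := fun s => s ^ 16)
    (φ₁ := fun s => 16 * s ^ 15) (φ₂ := fun s => 16 * (15 * s ^ 14))
    (ψ := fun _ => 1) (ψ₁ := fun _ => 0) (ψ₂ := fun _ => 0)
    (fun s => (hasDerivAt_pow 16 s).congr_deriv (by norm_num))
    (fun s => ((hasDerivAt_pow 15 s).const_mul 16).congr_deriv (by norm_num))
    (by fun_prop) (by simp) (fun s => hasDerivAt_const s 1) (fun s => hasDerivAt_const s 0)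
    continuous_const
  have hplate : plateIntegral Lx Ly τ (fun t x y => 16 * (0 : ℝ) ^ 15
      * (1 * dz T t x y 1 - 1 * dz T t x y 0)) = 0 := by
    simp [plateIntegral]
  rw [hplate, add_zero] at key
  simp only [one_mul, zero_mul, add_zero] at key
  have cgrad : IsCont fun t x y z => dx T t x y z ^ 2 + dy T t x y z ^ 2 + dz T t x y z ^ 2 :=
    ((h.regular_T.dx.isCont.pow 2).add (h.regular_T.dy.isCont.pow 2)).add (cTz.pow 2)
  have c8 : IsCont fun t x y z => (8 * T t x y z ^ 7 * dz T t x y z) ^ 2 :=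
    (((isCont_const 8).mul (cT.pow 7)).mul cTz).pow 2
  have hardy := weighted_hardy (Lx := Lx) (Ly := Ly) (τ := τ) (g := fun t x y z => T t x y z ^ 8)
    (g' := fun t x y z => 8 * T t x y z ^ 7 * dz T t x y z) (cT.pow 8)
    (((isCont_const 8).mul (cT.pow 7)).mul cTz)
    (fun t x y z ht hz => by
      have : HasDerivWithinAt (fun s => T t x y s ^ 8) _ (Icc 0 1) z :=
        (hT1.hasDerivWithinAt_dz (x := x) (y := y) ht hz).pow 8
      exact this.congr_deriv (by norm_num))
    (fun t x y ht => by simp [h.bc_T t x y 0 ht (Or.inl rfl)]) 0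
  simp only [pow_zero, one_mul, CharP.cast_eq_zero, zero_add, one_pow, ← pow_mul,
    Nat.reduceMul] at hardy
  -- `T ^ 15 ≤ T ^ 16 / 32 + 32 ^ 15` keeps the source term below the dissipation.
  have h1 : spaceTimeIntegral Lx Ly τ (fun t x y z => 16 * T t x y z ^ 15
      - 16 * (15 * T t x y z ^ 14)
        * (dx T t x y z ^ 2 + dy T t x y z ^ 2 + dz T t x y z ^ 2))
      ≤ spaceTimeIntegral Lx Ly τ (fun t x y z => 2 ^ 79 + 1 / 2 * T t x y z ^ 16
        - 15 / 4 * (8 * T t x y z ^ 7 * dz T t x y z) ^ 2) := by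
    refine spaceTimeIntegral_mono (((isCont_const 16).mul (cT.pow 15)).sub
      (((isCont_const 16).mul ((isCont_const 15).mul (cT.pow 14))).mul cgrad))
      (((isCont_const _).add ((isCont_const _).mul (cT.pow 16))).sub
        ((isCont_const _).mul c8)) fun t x y z _ _ => ?_
    have e1 := pow_le_add_pow_div (abs_nonneg (T t x y z)) (by norm_num : (0 : ℝ) < 32) 15 1
    have e2 : T t x y z ^ 15 ≤ |T t x y z| ^ 15 := by
      rw [← abs_pow]
      exact le_abs_self _
    have e3 : |T t x y z| ^ 16 = T t x y z ^ 16 := Even.pow_abs (by decide) _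
    norm_num [e3] at e1
    have e4 : 0 ≤ T t x y z ^ 14 := Even.pow_nonneg (by decide) _
    have e5 := mul_nonneg e4 (sq_nonneg (dx T t x y z))
    have e6 := mul_nonneg e4 (sq_nonneg (dy T t x y z))
    nlinarith
  rw [spaceTimeIntegral_sub ((isCont_const _).add ((isCont_const _).mul (cT.pow 16)))
    ((isCont_const _).mul c8), spaceTimeIntegral_add (isCont_const _)
    ((isCont_const _).mul (cT.pow 16)), spaceTimeIntegral_const_mul, spaceTimeIntegral_const_mul,
    spaceTimeIntegral_const hLx.le hLy.le hτ] at h1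
  linarith

/-- Weighted means of the temperature grow sublinearly in time. -/
lemma exists_abs_cellIntegral_le (hLx : 0 < Lx) (hLy : 0 < Ly)
    (h : IsStressFreeSolution R Lx Ly u v w p T) {χ : ℝ → ℝ} (hχ : Continuous χ)
    (hχ1 : ∀ z ∈ Icc (0 : ℝ) 1, |χ z| ≤ 1) {ε : ℝ} (hε : 0 < ε) :
    ∃ C, ∀ τ, 0 ≤ τ → |cellIntegral Lx Ly (fun t x y z => χ z * T t x y z) τ|
      ≤ ε * (τ * (Lx * Ly)) + C := by
  have cT := h.regular_T.isCont
  -- `r` is chosen so large that `2 ^ 79 / r ^ 15 ≤ ε`.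
  set r : ℝ := 2 ^ 79 / ε + 1 with hr
  have hr1 : 1 ≤ r := by rw [hr]; linarith [show 0 ≤ 2 ^ 79 / ε by positivity]
  have hr0 : 0 < r := by linarith
  have hrε : 1 / r ^ 15 * 2 ^ 79 ≤ ε := by
    have e1 : r ≤ r ^ 15 := le_self_pow₀ hr1 (by norm_num)
    have e2 : 2 ^ 79 ≤ ε * r := by
      rw [hr, mul_add, mul_div_cancel₀ _ hε.ne']
      linarith
    rw [one_div, inv_mul_le_iff₀ (by positivity)]
    nlinarith
  refine ⟨Lx * Ly * r + 1 / r ^ 15 * cellIntegral Lx Ly (fun t x y z => T t x y z ^ 16) 0,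
    fun τ hτ => ?_⟩
  have hm := moment_bound hLx hLy hτ h
  have hJ : 0 ≤ spaceTimeIntegral Lx Ly τ (fun t x y z => T t x y z ^ 16) :=
    setIntegral_nonneg (measurableSet_Icc.prod measurableSet_cell)
      fun q _ => Even.pow_nonneg (by decide) _
  have hb : |cellIntegral Lx Ly (fun t x y z => χ z * T t x y z) τ|
      ≤ cellIntegral Lx Ly (fun t x y z => |χ z * T t x y z|) τ := abs_integral_le_integral_abs
  have hc : cellIntegral Lx Ly (fun t x y z => |χ z * T t x y z|) τ
      ≤ cellIntegral Lx Ly (fun t x y z => r + 1 / r ^ 15 * T t x y z ^ 16) τ := by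
    refine cellIntegral_mono (((isCont_height hχ).mul cT).comp continuous_abs)
      ((isCont_const _).add ((isCont_const _).mul (cT.pow 16))) hτ fun x y z hz => ?_
    have e1 := pow_le_add_pow_div (abs_nonneg (T τ x y z)) hr0 1 15
    have e3 : |T τ x y z| ^ (1 + 15) = T τ x y z ^ 16 := Even.pow_abs (by decide) _
    rw [e3, pow_one, pow_one] at e1
    rw [abs_mul]
    have e4 := mul_le_mul_of_nonneg_right (hχ1 z hz) (abs_nonneg (T τ x y z))
    calc |χ z| * |T τ x y z| ≤ 1 * |T τ x y z| := e4
      _ ≤ r + T τ x y z ^ 16 / r ^ 15 := by rwa [one_mul]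
      _ = _ := by ring
  rw [cellIntegral_add (isCont_const _) ((isCont_const _).mul (cT.pow 16)) hτ,
    cellIntegral_const_mul, cellIntegral_const hLx.le hLy.le] at hc
  have hm' : cellIntegral Lx Ly (fun t x y z => T t x y z ^ 16) τ
      ≤ cellIntegral Lx Ly (fun t x y z => T t x y z ^ 16) 0 + 2 ^ 79 * (τ * (Lx * Ly)) := by
    linarith
  have hm2 := mul_le_mul_of_nonneg_left hm' (by positivity : 0 ≤ 1 / r ^ 15)
  have hm3 := mul_le_mul_of_nonneg_right hrε (by positivity : 0 ≤ τ * (Lx * Ly))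
  linarith

end Bounds

/-! ### The heat flux -/

lemma hasDerivAt_one_sub_pow (m : ℕ) (z : ℝ) :
    HasDerivAt (fun s : ℝ => (1 - s) ^ (m + 1)) (-((m + 1) * (1 - z) ^ m)) z := by
  have : HasDerivAt (fun s : ℝ => (1 - s) ^ (m + 1)) _ z :=
    ((hasDerivAt_id z).const_sub 1).pow (m + 1)
  exact this.congr_deriv (by simp)

/-- Pointwise bound of the convective flux near the bottom plate. The linear term with coefficient
`l / (2 * a)` is provided by the curvature of the test profile; it absorbs the part of `θ ^ 2` that
is not controlled by the sixteenth moment. -/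
lemma convection_le_pointwise {a l k P s ω θ : ℝ} (ha : 0 < a) (hl : 0 < l) (hP0 : 0 ≤ P)
    (hP1 : P ≤ 1) :
    k * (P ^ 2 * s) * (ω * θ) - l / (2 * a) * (P ^ 2 * θ)
      ≤ a / 2 * k ^ 2 * (P ^ 2 * s ^ 2 * ω ^ 2)
        + 1 / (2 * a) * (1 / l ^ 14 * θ ^ 16 + 2 * l * -min θ 0) := by
  have h1 : θ ^ 2 ≤ l * θ + (1 / l ^ 14 * θ ^ 16 + 2 * l * -min θ 0) := by
    have e1 := mul_le_mul_of_nonneg_left (pow_le_add_pow_div (abs_nonneg θ) hl 1 14)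
      (abs_nonneg θ)
    have e2 : |θ| * (l ^ 1 + |θ| ^ (1 + 14) / l ^ 14) = l * |θ| + 1 / l ^ 14 * |θ| ^ 16 := by ring
    have e3 : |θ| ^ 16 = θ ^ 16 := Even.pow_abs (by decide) _
    have e4 : |θ| = θ + 2 * -min θ 0 := by
      rcases le_total θ 0 with h | h
      · rw [abs_of_nonpos h, min_eq_left h]; ring
      · rw [abs_of_nonneg h, min_eq_right h]; ring
    rw [e2, e3] at e1
    have e5 : |θ| * |θ| ^ 1 = θ ^ 2 := by rw [pow_one, ← sq, sq_abs]
    rw [e5, e4] at e1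
    linarith
  have h2 : 0 ≤ 1 / l ^ 14 * θ ^ 16 + 2 * l * -min θ 0 := by
    have e1 : 0 ≤ -min θ 0 := by simp
    have e2 : 0 ≤ θ ^ 16 := Even.pow_nonneg (by decide) _
    positivity
  have h3 : P ^ 2 * (1 / l ^ 14 * θ ^ 16 + 2 * l * -min θ 0)
      ≤ 1 * (1 / l ^ 14 * θ ^ 16 + 2 * l * -min θ 0) :=
    mul_le_mul_of_nonneg_right (pow_le_one₀ hP0 hP1) h2
  have h4 : P ^ 2 * θ ^ 2 ≤ P ^ 2 * (l * θ) + (1 / l ^ 14 * θ ^ 16 + 2 * l * -min θ 0) := by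
    have := mul_le_mul_of_nonneg_left h1 (sq_nonneg P)
    linarith
  have h5 := mul_le_mul_of_nonneg_left h4 (by positivity : 0 ≤ 1 / (2 * a))
  have h6 : k * (P ^ 2 * s) * (ω * θ)
      ≤ a / 2 * k ^ 2 * (P ^ 2 * s ^ 2 * ω ^ 2) + 1 / (2 * a) * (P ^ 2 * θ ^ 2) := by
    have e1 : 0 ≤ P ^ 2 * (1 / (2 * a)) * (a * k * s * ω - θ) ^ 2 := by positivity
    have e2 : P ^ 2 * (1 / (2 * a)) * (a * k * s * ω - θ) ^ 2
        = a / 2 * k ^ 2 * (P ^ 2 * s ^ 2 * ω ^ 2) + 1 / (2 * a) * (P ^ 2 * θ ^ 2)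
          - k * (P ^ 2 * s) * (ω * θ) := by
      field_simp
      ring
    linarith
  have h7 : 1 / (2 * a) * (P ^ 2 * (l * θ)) = l / (2 * a) * (P ^ 2 * θ) := by ring
  linarith

/-- Absorption of a small multiple `i / 8` of the convective flux `I` into the left-hand side. -/
lemma le_of_absorbed {i I V B D : ℝ} (hi0 : 0 < i) (hi2 : i ≤ 1 / 2) (hV : 0 ≤ V) (hD : 0 ≤ D)
    (hBD : B ≤ D) (h : (1 - i / 8) * I ≤ (1 / 2 - 3 / 8 * i) * V + B) :
    I ≤ (1 / 2 - i / 4) * V + 2 * D := by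
  have h1 : 1 / 2 - 3 / 8 * i ≤ (1 - i / 8) * (1 / 2 - i / 4) := by nlinarith
  have h2 := mul_le_mul_of_nonneg_right h1 hV
  have h3 := mul_le_mul_of_nonneg_right (by linarith : 1 / 2 ≤ 1 - i / 8)
    (by linarith : 0 ≤ 2 * D)
  have h4 : (1 - i / 8) * I ≤ (1 - i / 8) * ((1 / 2 - i / 4) * V + 2 * D) := by linarith
  exact le_of_mul_le_mul_left h4 (by linarith)

section Flux

variable {R Lx Ly τ : ℝ} {u v w p T : ScalarField}

/-- The heat flux out of the bottom plate, from the balance of `(1 - z) T`. -/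
lemma plateIntegral_bottom (hLx : 0 < Lx) (hLy : 0 < Ly) (hτ : 0 ≤ τ)
    (h : IsStressFreeSolution R Lx Ly u v w p T) :
    plateIntegral Lx Ly τ (fun t x y => dz T t x y 0)
      = τ * (Lx * Ly) / 2 - spaceTimeIntegral Lx Ly τ (fun t x y z => w t x y z * T t x y z)
        - (cellIntegral Lx Ly (fun t x y z => (1 - z) * T t x y z) τ
          - cellIntegral Lx Ly (fun t x y z => (1 - z) * T t x y z) 0) := by
  have key := temperature_balance hLx.le hLy.le hτ h (φ := fun s => s)
    (φ₁ := fun _ => 1) (φ₂ := fun _ => 0)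
    (ψ := fun z => 1 - z) (ψ₁ := fun _ => -1) (ψ₂ := fun _ => 0)
    (fun s => hasDerivAt_id s) (fun s => hasDerivAt_const s 1) continuous_const rfl
    (fun s => (hasDerivAt_id s).const_sub 1) (fun s => hasDerivAt_const s (-1))
    continuous_const
  have hplate : plateIntegral Lx Ly τ (fun t x y => (1 : ℝ)
      * ((1 - 1) * dz T t x y 1 - (1 - 0) * dz T t x y 0))
      = -plateIntegral Lx Ly τ (fun t x y => dz T t x y 0) := by
    simp [plateIntegral, integral_neg]
  rw [hplate] at key
  have hψ := spaceTimeIntegral_height hLx.le hLy.le hτ (fun z => 1 - z)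
  have hint : ∫ z in Icc (0 : ℝ) 1, (1 - z) = 1 / 2 := by
    rw [setIntegral_Icc_eq_sub (F := fun z => z - z ^ 2 / 2) zero_le_one
      (fun z _ => (((hasDerivAt_id z).sub ((hasDerivAt_pow 2 z).div_const 2)).congr_deriv
        (by norm_num)).hasDerivWithinAt) (by fun_prop)]
    norm_num
  have hS : spaceTimeIntegral Lx Ly τ (fun t x y z => (1 - z) * 1 + 0 * T t x y z
      + -1 * (w t x y z * T t x y z)
      - (1 - z) * (0 * (dx T t x y z ^ 2 + dy T t x y z ^ 2 + dz T t x y z ^ 2)))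
      = spaceTimeIntegral Lx Ly τ (fun t x y z => (1 - z) - w t x y z * T t x y z) :=
    spaceTimeIntegral_congr fun t x y z _ _ => by ring
  rw [hS, spaceTimeIntegral_sub (isCont_height (by fun_prop))
    (h.regular_w.isCont.mul h.regular_T.isCont), hψ, hint] at key
  linarith

/-- The balance of `ψ(z) T` with the profile `ψ = (1 - z) - (1 - z)^k`, `k = 2 j + 2`, which
vanishes at both plates and whose curvature is concentrated in a layer of thickness `1 / k` at the
bottom. -/
lemma layer_balance (hLx : 0 < Lx) (hLy : 0 < Ly) (hτ : 0 ≤ τ)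
    (h : IsStressFreeSolution R Lx Ly u v w p T) (j : ℕ) :
    cellIntegral Lx Ly (fun t x y z => ((1 - z) - (1 - z) ^ (2 * j + 2)) * T t x y z) τ
        - cellIntegral Lx Ly (fun t x y z => ((1 - z) - (1 - z) ^ (2 * j + 2)) * T t x y z) 0
      = τ * (Lx * Ly) * (1 / 2 - 1 / (2 * j + 3))
        - spaceTimeIntegral Lx Ly τ (fun t x y z => w t x y z * T t x y z)
        + spaceTimeIntegral Lx Ly τ (fun t x y z =>
          (2 * j + 2) * (1 - z) ^ (2 * j + 1) * (w t x y z * T t x y z)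
          - (2 * j + 2) * (2 * j + 1) * ((1 - z) ^ (2 * j) * T t x y z)) := by
  have cw := h.regular_w.isCont
  have cT := h.regular_T.isCont
  have key := temperature_balance hLx.le hLy.le hτ h (φ := fun s => s)
    (φ₁ := fun _ => 1) (φ₂ := fun _ => 0)
    (ψ := fun z => (1 - z) - (1 - z) ^ (2 * j + 2))
    (ψ₁ := fun z => -1 + (2 * j + 2) * (1 - z) ^ (2 * j + 1))
    (ψ₂ := fun z => -((2 * j + 2) * ((2 * j + 1) * (1 - z) ^ (2 * j))))
    (fun s => hasDerivAt_id s) (fun s => hasDerivAt_const s 1) continuous_const rfl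
    (fun s => (((hasDerivAt_id s).const_sub 1).sub
      (hasDerivAt_one_sub_pow (2 * j + 1) s)).congr_deriv (by push_cast; ring))
    (fun s => (((hasDerivAt_one_sub_pow (2 * j) s).const_mul (2 * j + 2 : ℝ)).const_add
      (-1)).congr_deriv (by push_cast; ring))
    (by fun_prop)
  have hplate : plateIntegral Lx Ly τ (fun t x y => (1 : ℝ)
      * (((1 - 1) - (1 - 1) ^ (2 * j + 2)) * dz T t x y 1
        - ((1 - 0) - (1 - 0) ^ (2 * j + 2)) * dz T t x y 0)) = 0 := by
    simp [plateIntegral]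
  rw [hplate, add_zero] at key
  have hψ := spaceTimeIntegral_height hLx.le hLy.le hτ (fun z => (1 - z) - (1 - z) ^ (2 * j + 2))
  have hint : ∫ z in Icc (0 : ℝ) 1, ((1 - z) - (1 - z) ^ (2 * j + 2))
      = 1 / 2 - 1 / (2 * j + 3) := by
    have hj : (2 * j + 3 : ℝ) ≠ 0 := by positivity
    rw [setIntegral_Icc_eq_sub
      (F := fun z => z - z ^ 2 / 2 + (1 - z) ^ (2 * j + 2 + 1) / (2 * j + 3)) zero_le_one
      (fun z _ => ((((hasDerivAt_id z).sub ((hasDerivAt_pow 2 z).div_const 2)).add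
        ((hasDerivAt_one_sub_pow (2 * j + 2) z).div_const (2 * j + 3))).congr_deriv
        (by push_cast; field_simp; ring)).hasDerivWithinAt) (by fun_prop)]
    norm_num
  have c1 (m : ℕ) : IsCont fun _ _ _ z => (1 - z) ^ m := isCont_height (by fun_prop)
  have cL : IsCont fun t x y z => (2 * j + 2) * (1 - z) ^ (2 * j + 1) * (w t x y z * T t x y z)
      - (2 * j + 2) * (2 * j + 1) * ((1 - z) ^ (2 * j) * T t x y z) :=
    (((isCont_const _).mul (c1 _)).mul (cw.mul cT)).sub ((isCont_const _).mul ((c1 _).mul cT))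
  have cψ : IsCont fun _ _ _ z => (1 - z) - (1 - z) ^ (2 * j + 2) := isCont_height (by fun_prop)
  rw [key, ← hint, ← hψ, ← spaceTimeIntegral_sub cψ (cw.mul cT),
    ← spaceTimeIntegral_add (cψ.sub (cw.mul cT)) cL]
  exact spaceTimeIntegral_congr fun t x y z _ _ => by ring

/-- The mean convective flux stays below `1 / 2` by an amount comparable to `1 / k`, as soon as
the thickness `1 / k` of the test layer is small compared with a power of `1 / R`. -/
lemma exists_convection_le (hR : 1 ≤ R) (hLx : 0 < Lx) (hLy : 0 < Ly)
    (h : IsStressFreeSolution R Lx Ly u v w p T) {j : ℕ}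
    (hj : 2 ^ 130 * R ^ 15 * (2 * j + 2 : ℝ) ^ 2 ≤ (2 * j + 1 : ℝ) ^ 14) :
    ∃ C, ∀ τ, 0 ≤ τ → spaceTimeIntegral Lx Ly τ (fun t x y z => w t x y z * T t x y z)
      ≤ (1 / 2 - 1 / (4 * (2 * j + 2))) * (τ * (Lx * Ly)) + C := by
  have cw := h.regular_w.isCont
  have cT := h.regular_T.isCont
  have c1 (m : ℕ) : IsCont fun _ _ _ z => (1 - z) ^ m := isCont_height (by fun_prop)
  have hR0 : 0 < R := by linarith
  obtain ⟨k, hk⟩ : ∃ k : ℝ, k = 2 * j + 2 := ⟨_, rfl⟩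
  have hk2 : 2 ≤ k := by rw [hk]; linarith [show (0 : ℝ) ≤ j from Nat.cast_nonneg j]
  have hk0 : 0 < k := by linarith
  have hk1 : (2 * j + 1 : ℝ) = k - 1 := by rw [hk]; ring
  have hk3 : (2 * j + 3 : ℝ) = k + 1 := by rw [hk]; ring
  obtain ⟨C₁, hC₁⟩ := exists_negPart_le hLx hLy h (ε := 1 / (64 * k ^ 3)) (by positivity)
  obtain ⟨C₂, hC₂⟩ := exists_abs_cellIntegral_le hLx hLy h
    (χ := fun z => (1 - z) - (1 - z) ^ (2 * j + 2)) (by fun_prop) (fun z hz => by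
      have e1 : 0 ≤ 1 - z := by linarith [hz.2]
      have e2 : 1 - z ≤ 1 := by linarith [hz.1]
      have e3 : (1 - z) ^ (2 * j + 2) ≤ 1 - z := pow_le_of_le_one e1 e2 (by omega)
      have e4 : 0 ≤ (1 - z) ^ (2 * j + 2) := by positivity
      rw [abs_le]
      constructor <;> linarith) (ε := 1 / (32 * k)) (by positivity)
  -- `a` is the Young weight: with it, the dissipation term is at most a fraction `1 / (8 k)` of
  -- the convective flux. `l` is the resulting temperature threshold.
  set a : ℝ := 1 / (16 * R * k) with ha
  set l : ℝ := (k - 1) / (8 * R) with hl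
  have ha0 : 0 < a := by positivity
  have hl0 : 0 < l := div_pos (by linarith) (by positivity)
  have hla : l / (2 * a) = k * (k - 1) := by
    rw [ha, hl]
    field_simp
    ring
  set K₀ := cellIntegral Lx Ly (fun t x y z => T t x y z ^ 16) 0 with hK₀
  set C₀ := cellIntegral Lx Ly
    (fun t x y z => ((1 - z) - (1 - z) ^ (2 * j + 2)) * T t x y z) 0 with hC₀
  have hlM : 1 / (2 * a) * (1 / l ^ 14) * 2 ^ 81 ≤ 1 / (16 * k) := by
    rw [hk1, ← hk] at hj
    have e0 : 0 < (k - 1) ^ 14 := pow_pos (by linarith) _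
    have e1 : 1 / (2 * a) * (1 / l ^ 14) * 2 ^ 81
        = (2 ^ 130 * R ^ 15 * k ^ 2) / (k - 1) ^ 14 * (1 / (16 * k)) := by
      rw [ha, hl]
      field_simp
      norm_num
    rw [e1]
    have e2 : (2 ^ 130 * R ^ 15 * k ^ 2) / (k - 1) ^ 14 ≤ 1 := (div_le_one₀ e0).2 hj
    exact mul_le_of_le_one_left (by positivity) e2
  have hlN : 1 / (2 * a) * (2 * l) * (1 / (64 * k ^ 3)) ≤ 1 / (32 * k) := by
    have e1 : 1 / (2 * a) * (2 * l) = 2 * (l / (2 * a)) := by ring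
    rw [e1, hla]
    have e2 : 2 * (k * (k - 1)) * (1 / (64 * k ^ 3)) = (k - 1) / k * (1 / (32 * k)) := by
      field_simp
      ring
    rw [e2]
    exact mul_le_of_le_one_left (by positivity) ((div_le_one₀ hk0).2 (by linarith))
  set B := C₂ + |C₀| + 1 / (2 * a) * (1 / l ^ 14) * (4 * |K₀|) + 1 / (2 * a) * (2 * l) * |C₁|
    with hB
  have hB0 : 0 ≤ B + |C₂| := by
    have e1 := neg_abs_le C₂
    have e2 : 0 ≤ |C₀| + 1 / (2 * a) * (1 / l ^ 14) * (4 * |K₀|)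
      + 1 / (2 * a) * (2 * l) * |C₁| := by positivity
    linarith
  refine ⟨2 * (B + |C₂|), fun τ hτ => ?_⟩
  have hV : 0 ≤ τ * (Lx * Ly) := by positivity
  set I := spaceTimeIntegral Lx Ly τ (fun t x y z => w t x y z * T t x y z) with hI
  set W := spaceTimeIntegral Lx Ly τ (fun t x y z => (1 - z) ^ (2 * j + 2) * w t x y z ^ 2) with hW
  set M := spaceTimeIntegral Lx Ly τ (fun t x y z => T t x y z ^ 16) with hM
  set N := spaceTimeIntegral Lx Ly τ (fun t x y z => -min (T t x y z) 0) with hN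
  have hD := dissipation_le hLx.le hLy.le hτ h
  have hD0 : 0 ≤ spaceTimeIntegral Lx Ly τ (fun t x y z => dz w t x y z ^ 2) :=
    setIntegral_nonneg (measurableSet_Icc.prod measurableSet_cell) fun q _ => sq_nonneg _
  have hW0 : 0 ≤ W :=
    setIntegral_nonneg (measurableSet_Icc.prod measurableSet_cell) fun q hq =>
      mul_nonneg (pow_nonneg (sub_nonneg.2 hq.2.2.2.2) _) (sq_nonneg _)
  have hI0 : 0 ≤ I := by
    by_contra hneg
    nlinarith
  have hWI : k ^ 2 * W ≤ 4 * (R * I) := by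
    have hardy := weighted_hardy (Lx := Lx) (Ly := Ly) (τ := τ) cw h.regular_w.dz.isCont
      (fun t x y z ht hz => (h.regular_w.of_le one_le_two).hasDerivWithinAt_dz ht hz)
      (fun t x y ht => h.bc_w t x y 0 ht (Or.inl rfl)) (2 * j + 2)
    push_cast at hardy
    rw [← hk, ← hW] at hardy
    nlinarith
  have hMle : M ≤ 2 ^ 81 * (τ * (Lx * Ly)) + 4 * |K₀| := by
    have e1 := moment_bound hLx hLy hτ h
    have e2 : 0 ≤ cellIntegral Lx Ly (fun t x y z => T t x y z ^ 16) τ :=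
      setIntegral_nonneg measurableSet_cell fun q _ => Even.pow_nonneg (by decide) _
    rw [← hK₀, ← hM] at e1
    have e3 := le_abs_self K₀
    have e4 := abs_nonneg K₀
    linarith
  have hNle : N ≤ 1 / (64 * k ^ 3) * (τ * (Lx * Ly)) + |C₁| :=
    (hC₁ τ hτ).trans (by linarith [le_abs_self C₁])
  have hK := hC₂ τ hτ
  have hbal := layer_balance hLx hLy hτ h j
  have cN : IsCont fun t x y z => -min (T t x y z) 0 :=
    cT.comp (φ := fun s => -min s 0) (by fun_prop)
  have hlayer : spaceTimeIntegral Lx Ly τ (fun t x y z =>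
      (2 * j + 2) * (1 - z) ^ (2 * j + 1) * (w t x y z * T t x y z)
      - (2 * j + 2) * (2 * j + 1) * ((1 - z) ^ (2 * j) * T t x y z))
      ≤ spaceTimeIntegral Lx Ly τ (fun t x y z =>
        a / 2 * k ^ 2 * ((1 - z) ^ (2 * j + 2) * w t x y z ^ 2)
        + 1 / (2 * a) * (1 / l ^ 14 * T t x y z ^ 16 + 2 * l * -min (T t x y z) 0)) := by
    refine spaceTimeIntegral_mono
      ((((isCont_const _).mul (c1 _)).mul (cw.mul cT)).sub
        ((isCont_const _).mul ((c1 _).mul cT)))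
      (((isCont_const _).mul ((c1 _).mul (cw.pow 2))).add ((isCont_const _).mul
        (((isCont_const _).mul (cT.pow 16)).add ((isCont_const _).mul cN))))
      fun t x y z _ hz => ?_
    have e0 : 0 ≤ 1 - z := by linarith [hz.2]
    have e1 : 1 - z ≤ 1 := by linarith [hz.1]
    have e2 := convection_le_pointwise (k := k) (s := 1 - z) (ω := w t x y z) (θ := T t x y z)
      ha0 hl0 (pow_nonneg e0 j) (pow_le_one₀ e0 e1)
    rw [hla] at e2
    rw [← hk, hk1]
    calc _ = k * (((1 - z) ^ j) ^ 2 * (1 - z)) * (w t x y z * T t x y z)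
          - k * (k - 1) * (((1 - z) ^ j) ^ 2 * T t x y z) := by ring
      _ ≤ _ := e2
      _ = _ := by ring
  rw [spaceTimeIntegral_add ((isCont_const _).mul ((c1 _).mul (cw.pow 2))) ((isCont_const _).mul
        (((isCont_const _).mul (cT.pow 16)).add ((isCont_const _).mul cN))),
    spaceTimeIntegral_const_mul, spaceTimeIntegral_const_mul,
    spaceTimeIntegral_add ((isCont_const _).mul (cT.pow 16)) ((isCont_const _).mul cN),
    spaceTimeIntegral_const_mul, spaceTimeIntegral_const_mul, ← hW, ← hM, ← hN] at hlayer
  rw [← hC₀, ← hI, hk3] at hbal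
  have e1 : a / 2 * k ^ 2 * W ≤ 1 / (8 * k) * I := by
    have := mul_le_mul_of_nonneg_left hWI (by positivity : 0 ≤ a / 2)
    have e : a / 2 * (4 * (R * I)) = 1 / (8 * k) * I := by
      rw [ha]
      field_simp
      ring
    linarith
  have e2 : 1 / (2 * a) * (1 / l ^ 14) * M
      ≤ 1 / (16 * k) * (τ * (Lx * Ly)) + 1 / (2 * a) * (1 / l ^ 14) * (4 * |K₀|) := by
    have e3 := mul_le_mul_of_nonneg_left hMle (by positivity : 0 ≤ 1 / (2 * a) * (1 / l ^ 14))
    have e4 := mul_le_mul_of_nonneg_right hlM hV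
    linarith
  have e3 : 1 / (2 * a) * (2 * l) * N
      ≤ 1 / (32 * k) * (τ * (Lx * Ly)) + 1 / (2 * a) * (2 * l) * |C₁| := by
    have e3 := mul_le_mul_of_nonneg_left hNle (by positivity : 0 ≤ 1 / (2 * a) * (2 * l))
    have e4 := mul_le_mul_of_nonneg_right hlN hV
    linarith
  have e4 := neg_abs_le (cellIntegral Lx Ly
    (fun t x y z => ((1 - z) - (1 - z) ^ (2 * j + 2)) * T t x y z) τ)
  have e5 := le_abs_self C₀
  -- with `i = 1 / k`, the estimates add up to `I (1 - i / 8) ≤ (1 / 2 - 3 i / 8) τ V + B`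
  obtain ⟨i, hi⟩ : ∃ i : ℝ, i = 1 / k := ⟨_, rfl⟩
  have hi0 : 0 < i := by rw [hi]; positivity
  have hi2 : i ≤ 1 / 2 := by rw [hi]; exact one_div_le_one_div_of_le (by norm_num) hk2
  have f1 : 1 / (8 * k) = i / 8 := by rw [hi]; ring
  have f2 : 1 / (16 * k) = i / 16 := by rw [hi]; ring
  have f3 : 1 / (32 * k) = i / 32 := by rw [hi]; ring
  have f4 : 1 / (4 * k) = i / 4 := by rw [hi]; ring
  have f5 : i / 2 ≤ 1 / (k + 1) := by
    rw [hi, div_div]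
    exact one_div_le_one_div_of_le (by positivity) (by linarith)
  rw [f1] at e1
  rw [f2] at e2
  rw [f3] at e3 hK
  rw [← hk, f4]
  have f6 := mul_le_mul_of_nonneg_right f5 hV
  have hsum : (1 - i / 8) * I ≤ (1 / 2 - 3 / 8 * i) * (τ * (Lx * Ly)) + B := by
    rw [hB]
    linarith
  exact le_of_absorbed hi0 hi2 hV hB0 (le_add_of_nonneg_right (abs_nonneg _)) hsum

end Flux

/-! ### Long-time averages and the bound as a function of the Rayleigh number -/

lemma longTimeAverage_le_of_integral_le {g : ℝ → ℝ} {c δ C : ℝ} (hδ : 0 < δ)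
    (h : ∀ τ, 0 ≤ τ → ∫ t in (0 : ℝ)..τ, g t ≤ (c - δ) * τ + C) :
    longTimeAverage g ≤ (c : EReal) := by
  refine limsup_le_of_le (h := ?_)
  filter_upwards [eventually_gt_atTop 0, eventually_ge_atTop (C / δ)] with τ hτ hC
  rw [EReal.coe_le_coe_iff, one_div, inv_mul_le_iff₀ hτ]
  rw [div_le_iff₀ hδ] at hC
  linarith [h τ hτ.le]

lemma le_longTimeAverage_of_le_integral {g : ℝ → ℝ} {c δ C : ℝ} (hδ : 0 < δ)
    (h : ∀ τ, 0 ≤ τ → (c + δ) * τ - C ≤ ∫ t in (0 : ℝ)..τ, g t) :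
    (c : EReal) ≤ longTimeAverage g := by
  refine le_limsup_of_frequently_le (Eventually.frequently ?_)
  filter_upwards [eventually_gt_atTop 0, eventually_ge_atTop (C / δ)] with τ hτ hC
  rw [EReal.coe_le_coe_iff, one_div, le_inv_mul_iff₀ hτ]
  rw [div_le_iff₀ hδ] at hC
  linarith [h τ hτ.le]

/-- For large Rayleigh numbers the stated bound is smaller than a multiple of `R ^ (-4 / 3)`, since
`4 / 3 < 40 / 29`. -/
lemma eventually_stressFreeBound_le :
    ∀ᶠ R : ℝ in atTop, stressFreeBound R ≤ 1 / (48 * (R ^ ((1 : ℝ) / 3)) ^ 4) := by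
  have hm₁ : 0 ≤ m₁ := by unfold m₁; positivity
  have hm₂ : 0 ≤ m₂ := by unfold m₂; positivity
  have hm₃ : 0 ≤ m₃ := by unfold m₃; positivity
  have t1 : Tendsto (fun R : ℝ => m₃ * R ^ (-((10 : ℝ) / 29))) atTop (nhds (m₃ * 0)) :=
    (tendsto_rpow_neg_atTop (by norm_num)).const_mul _
  have t2 : Tendsto (fun R : ℝ => (m₁ + 2 * m₂ * m₃) * R ^ (-((4 : ℝ) / 87))) atTop
      (nhds ((m₁ + 2 * m₂ * m₃) * 0)) :=
    (tendsto_rpow_neg_atTop (by norm_num)).const_mul _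
  rw [mul_zero] at t1 t2
  filter_upwards [eventually_ge_atTop 1, t1.eventually_le_const (by norm_num : (0 : ℝ) < 1 / 2),
    t2.eventually_le_const (by norm_num : (0 : ℝ) < 1 / 48)] with R hR h1 h2
  have hR0 : 0 < R := by linarith
  rw [← neg_div] at h1
  set x := m₃ * R ^ (-(10 : ℝ) / 29) with hx
  have hx0 : 0 ≤ x := by positivity
  have hlog : -Real.log (1 - x) ≤ 2 * x := by
    have e1 := Real.one_sub_inv_le_log_of_pos (by linarith : 0 < 1 - x)
    have e2 : (1 - x)⁻¹ ≤ 1 + 2 * x := by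
      rw [inv_le_iff_one_le_mul₀ (by linarith)]
      nlinarith
    linarith
  have hprod : R ^ (-(35 : ℝ) / 29) * x ≤ m₃ * R ^ (-(40 : ℝ) / 29) := by
    have e1 : R ^ (-(35 : ℝ) / 29) * x = m₃ * R ^ (-(45 : ℝ) / 29) := by
      rw [hx, mul_left_comm, ← Real.rpow_add hR0]
      norm_num
    rw [e1]
    exact mul_le_mul_of_nonneg_left (Real.rpow_le_rpow_of_exponent_le hR (by norm_num)) hm₃
  have hsplit : R ^ (-(40 : ℝ) / 29) = R ^ (-((4 : ℝ) / 87)) * R ^ (-(4 : ℝ) / 3) := by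
    rw [← Real.rpow_add hR0]
    norm_num
  have hpow : 1 / (48 * (R ^ ((1 : ℝ) / 3)) ^ 4) = 1 / 48 * R ^ (-(4 : ℝ) / 3) := by
    rw [← Real.rpow_natCast, ← Real.rpow_mul hR0.le, neg_div, Real.rpow_neg hR0.le]
    norm_num
    ring
  have hlog2 := mul_le_mul_of_nonneg_left hlog
    (by positivity : 0 ≤ m₂ * R ^ (-(35 : ℝ) / 29))
  have hprod2 := mul_le_mul_of_nonneg_left hprod (by positivity : 0 ≤ 2 * m₂)
  calc stressFreeBound R ≤ (m₁ + 2 * m₂ * m₃) * R ^ (-(40 : ℝ) / 29) := by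
        rw [stressFreeBound, ← hx]
        linarith
    _ = (m₁ + 2 * m₂ * m₃) * R ^ (-((4 : ℝ) / 87)) * R ^ (-(4 : ℝ) / 3) := by
        rw [hsplit]
        ring
    _ ≤ 1 / 48 * R ^ (-(4 : ℝ) / 3) := by gcongr
    _ = _ := hpow.symm

/-- A layer thickness `1 / (2 j + 2)` comparable to `R ^ (-4 / 3)` is admissible for large `R`. -/
lemma exists_layer {R : ℝ} (hR : 2 ^ 122 ≤ R) :
    ∃ j : ℕ, 2 ^ 130 * R ^ 15 * (2 * j + 2 : ℝ) ^ 2 ≤ (2 * j + 1 : ℝ) ^ 14 ∧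
      1 / (48 * (R ^ ((1 : ℝ) / 3)) ^ 4) ≤ 1 / (8 * (2 * j + 2 : ℝ)) := by
  have hR1 : 1 ≤ R := le_trans (by norm_num) hR
  obtain ⟨s, hs⟩ : ∃ s : ℝ, s = R ^ ((1 : ℝ) / 3) := ⟨_, rfl⟩
  have hs1 : 1 ≤ s := hs ▸ Real.one_le_rpow hR1 (by norm_num)
  have hs3 : R = s ^ 3 := by
    rw [hs, ← Real.rpow_natCast, ← Real.rpow_mul (by linarith)]
    norm_num
  have hs4 : 1 ≤ s ^ 4 := one_le_pow₀ hs1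
  have hj1 : s ^ 4 ≤ (⌈s ^ 4⌉₊ : ℝ) := Nat.le_ceil _
  have hj2 : (⌈s ^ 4⌉₊ : ℝ) < s ^ 4 + 1 := Nat.ceil_lt_add_one (by positivity)
  have hk : (2 * ⌈s ^ 4⌉₊ + 2 : ℝ) ≤ 6 * s ^ 4 := by linarith
  refine ⟨⌈s ^ 4⌉₊, ?_, ?_⟩
  · calc 2 ^ 130 * R ^ 15 * (2 * ⌈s ^ 4⌉₊ + 2 : ℝ) ^ 2
        ≤ 2 ^ 130 * R ^ 15 * (6 * s ^ 4) ^ 2 := by gcongr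
      _ = 36 * 2 ^ 130 * s ^ 53 := by rw [hs3]; ring
      _ ≤ 2 ^ 14 * 2 ^ 122 * s ^ 53 :=
        mul_le_mul_of_nonneg_right (by norm_num) (by positivity)
      _ ≤ 2 ^ 14 * R * s ^ 53 := by gcongr
      _ = (2 * s ^ 4) ^ 14 := by rw [hs3]; ring
      _ ≤ (2 * ⌈s ^ 4⌉₊ + 1 : ℝ) ^ 14 := by gcongr; linarith
  · rw [← hs]
    exact one_div_le_one_div_of_le (by positivity) (by linarith)

end HeatedConvection

theorem mainTheorem2 :
    ∃ R₀ : ℝ, 1 < R₀ ∧ ∀ R : ℝ, R₀ < R → ∀ Lx Ly : ℝ, 0 < Lx → 0 < Ly →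
      ∀ u v w p T : HeatedConvection.ScalarField,
        HeatedConvection.IsStressFreeSolution R Lx Ly u v w p T →
          (HeatedConvection.stressFreeBound R : EReal) ≤ HeatedConvection.bottomFlux Lx Ly T ∧
          (HeatedConvection.stressFreeBound R : EReal)
            ≤ ((1 / 2 : ℝ) : EReal) - HeatedConvection.meanConvectiveFlux Lx Ly w T := by
  open HeatedConvection in
  obtain ⟨R₁, hR₁⟩ := eventually_atTop.1 eventually_stressFreeBound_le
  refine ⟨max R₁ (2 ^ 122), lt_max_of_lt_right (by norm_num), ?_⟩
  intro R hR Lx Ly hLx hLy u v w p T h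
  have hRbig : 2 ^ 122 ≤ R := (le_max_right _ _).trans hR.le
  obtain ⟨j, hj, hjb⟩ := exists_layer hRbig
  have hb := (hR₁ R ((le_max_left _ _).trans hR.le)).trans hjb
  -- In terms of `i = 1 / (2 j + 2)`, the stated bound is at most `i / 8`.
  obtain ⟨i, hi⟩ : ∃ i : ℝ, i = 1 / (2 * j + 2 : ℝ) := ⟨_, rfl⟩
  have hi0 : 0 < i := by rw [hi]; positivity
  have hi8 : 1 / (8 * (2 * j + 2 : ℝ)) = i / 8 := by
    rw [hi, div_div, mul_comm (8 : ℝ)]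
  have hi4 : 1 / (4 * (2 * j + 2 : ℝ)) = i / 4 := by
    rw [hi, div_div, mul_comm (4 : ℝ)]
  rw [hi8] at hb
  obtain ⟨C, hC⟩ := exists_convection_le (le_trans (by norm_num) hRbig) hLx hLy h hj
  rw [hi4] at hC
  have hwT : IsCont fun t x y z => w t x y z * T t x y z :=
    h.regular_w.isCont.mul h.regular_T.isCont
  have hflux : meanConvectiveFlux Lx Ly w T ≤ ((1 / 2 - stressFreeBound R : ℝ) : EReal) := by
    refine longTimeAverage_le_of_integral_le (δ := i / 8) (C := 1 / (Lx * Ly) * C)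
      (by positivity) fun τ hτ => ?_
    rw [integral_volumeAverage hLx.le hLy.le hτ hwT]
    have e1 := mul_le_mul_of_nonneg_left (hC τ hτ) (by positivity : 0 ≤ 1 / (Lx * Ly))
    have e2 : 1 / (Lx * Ly) * ((1 / 2 - i / 4) * (τ * (Lx * Ly)) + C)
        = (1 / 2 - i / 4) * τ + 1 / (Lx * Ly) * C := by
      field_simp
    have e3 : (1 / 2 - i / 4) * τ ≤ (1 / 2 - stressFreeBound R - i / 8) * τ :=
      mul_le_mul_of_nonneg_right (by linarith) hτ
    linarith
  refine ⟨?_, ?_⟩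
  · obtain ⟨C', hC'⟩ := exists_abs_cellIntegral_le hLx hLy h (χ := fun z => 1 - z) (by fun_prop)
      (fun z hz => by rw [abs_le]; constructor <;> linarith [hz.1, hz.2])
      (ε := i / 16) (by positivity)
    set K₀ := cellIntegral Lx Ly (fun t x y z => (1 - z) * T t x y z) 0 with hK₀
    refine le_longTimeAverage_of_le_integral (δ := i / 16)
      (C := 1 / (Lx * Ly) * (C + C' - K₀)) (by positivity) fun τ hτ => ?_
    rw [integral_horizontalAverage hLx.le hLy.le hτ, plateIntegral_bottom hLx hLy hτ h, ← hK₀]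
    have e0 := (le_abs_self _).trans (hC' τ hτ)
    have e1 : (3 / 16 * i) * (τ * (Lx * Ly)) - (C + C' - K₀)
        ≤ τ * (Lx * Ly) / 2 - spaceTimeIntegral Lx Ly τ (fun t x y z => w t x y z * T t x y z)
          - (cellIntegral Lx Ly (fun t x y z => (1 - z) * T t x y z) τ - K₀) := by
      linarith [hC τ hτ]
    have e2 := mul_le_mul_of_nonneg_left e1 (by positivity : 0 ≤ 1 / (Lx * Ly))
    have e3 : 1 / (Lx * Ly) * ((3 / 16 * i) * (τ * (Lx * Ly)) - (C + C' - K₀))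
        = (3 / 16 * i) * τ - 1 / (Lx * Ly) * (C + C' - K₀) := by
      field_simp
    have e4 : (stressFreeBound R + i / 16) * τ ≤ (3 / 16 * i) * τ :=
      mul_le_mul_of_nonneg_right (by linarith) hτ
    linarith
  · have e1 := EReal.sub_le_sub (le_refl ((1 / 2 : ℝ) : EReal)) hflux
    refine le_trans (le_of_eq ?_) e1
    rw [← EReal.coe_sub]
    congr 1
    ring
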